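/- Let $N, D \ge 0$ be integers, let $U \subset \mathbb{R}^N$ be an open ball with coordinates $u^1,\dots,u^N$, and let $\xi_1,\dots,\xi_D$ be the standard basis of $\mathbb{Z}_{\ge 0}^D$. Let $$\hat{\mathcal A} = C^\infty(U)\big[\big[\{u^{\alpha,S} : 1\le\alpha\le N,\ |S|>0\}\cup\{\theta_\alpha^S : 1\le\alpha\le N,\ |S|\ge 0\}\big]\big]$$ be the real algebra of formal power series, with coefficients in the smooth functions on $U$, in the commuting variables $u^{\alpha,S}$ and the anticommuting variables $\theta_\alpha^S$, where $S$ runs over the multi-indices in $\mathbb{Z}_{\ge 0}^D$. Put $u^{\alpha,0}=u^\alpha$, and for $i=1,\dots,D$ let $$\partial_{x^i} = \sum_{\alpha,S}\Big(u^{\alpha,S+\xi_i}\frac{\partial}{\partial u^{\alpha,S}}+\theta_\alpha^{S+\xi_i}\frac{\partial}{\partial\theta_\alpha^S}\Big),$$ which are commuting derivations of $\hat{\mathcal A}$. For $0\le i\le D$ let $$\hat{\mathcal F}_i=\frac{\hat{\mathcal A}}{\partial_{x^1}\hat{\mathcal A}+\cdots+\partial_{x^i}\hat{\mathcal A}},\qquad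 \hat{\mathcal F}_0=\hat{\mathcal A},$$ and write $\mathbb{R}$ also for the image in $\hat{\mathcal F}_i$ of the constant series. Then for every $a\in\{1,\dots,D\}$ the sequence $$0\to\hat{\mathcal F}_{a-1}/\mathbb{R}\xrightarrow{\ \partial_{x^a}\ }\hat{\mathcal F}_{a-1}\xrightarrow{\ \int dx^a\ }\hat{\mathcal F}_a\to 0$$ is exact, where the first map is induced by $\partial_{x^a}$ and the second, $\int dx^a$, is the canonical projection. In particular, the kernel of the map induced by $\partial_{x^a}$ on $\hat{\mathcal F}_{a-1}$ is exactly $\mathbb{R}$. -/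

import Mathlib

open scoped Manifold ContDiff

noncomputable section

namespace JetCalculus

/-! ### Smooth functions on an open subset of `ℝ^N` -/

/-- The algebra `C^∞(U)` of smooth real functions on an open set `U ⊆ ℝ^N`. -/
abbrev Smooth {N : ℕ} (U : TopologicalSpace.Opens (EuclideanSpace ℝ (Fin N))) : Type :=
  C^∞⟮𝓘(ℝ, EuclideanSpace ℝ (Fin N)), U; 𝓘(ℝ, ℝ), ℝ⟯

section SmoothFunctions

variable {N : ℕ} {U : TopologicalSpace.Opens (EuclideanSpace ℝ (Fin N))}

/-- Extension of a function on `U` by zero; it is only used through its germs at points of `U`. -/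
def extendZero (f : U → ℝ) : EuclideanSpace ℝ (Fin N) → ℝ :=
  Function.extend Subtype.val f 0

theorem extendZero_apply (f : U → ℝ) (x : U) : extendZero f x = f x :=
  Subtype.val_injective.extend_apply f 0 x

theorem contDiffAt_extendZero (f : Smooth U) (x : U) :
    ContDiffAt ℝ ∞ (extendZero f) (x : EuclideanSpace ℝ (Fin N)) := by
  rw [← contMDiffAt_iff_contDiffAt]
  refine contMDiffAt_subtype_iff.1 ?_
  have h : (fun y : U => extendZero f (y : EuclideanSpace ℝ (Fin N))) = f :=
    funext fun y => extendZero_apply _ y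
  rw [h]
  exact f.contMDiff x

theorem contMDiff_partial (f : Smooth U) (α : Fin N) :
    ContMDiff 𝓘(ℝ, EuclideanSpace ℝ (Fin N)) 𝓘(ℝ, ℝ) ∞
      (fun x : U => fderiv ℝ (extendZero f) (x : EuclideanSpace ℝ (Fin N))
        (EuclideanSpace.single α 1)) := by
  intro x
  refine (contMDiffAt_subtype_iff (f := fun y : EuclideanSpace ℝ (Fin N) =>
    fderiv ℝ (extendZero f) y (EuclideanSpace.single α 1))).2 ?_
  rw [contMDiffAt_iff_contDiffAt]
  exact ((contDiffAt_extendZero f x).fderiv_right (m := ∞) (by simp)).clm_apply contDiffAt_const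

/-- Two functions with the same restriction to `U` have the same germs at points of `U`. -/
theorem eventuallyEq_of_restrict {g h : EuclideanSpace ℝ (Fin N) → ℝ}
    (H : ∀ y : U, g y = h y) (x : U) :
    g =ᶠ[nhds (x : EuclideanSpace ℝ (Fin N))] h := by
  filter_upwards [U.isOpen.mem_nhds x.2] with y hy using H ⟨y, hy⟩

/-- The partial derivative `∂/∂u^α : C^∞(U) → C^∞(U)`. -/
def partialU (α : Fin N) : Smooth U →ₗ[ℝ] Smooth U where
  toFun f := ⟨fun x => fderiv ℝ (extendZero f) (x : EuclideanSpace ℝ (Fin N))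
    (EuclideanSpace.single α 1), contMDiff_partial f α⟩
  map_add' f g := by
    ext x
    have h := eventuallyEq_of_restrict (g := extendZero (f + g : Smooth U))
      (h := extendZero f + extendZero g) (fun y => by simp [extendZero_apply]) x
    have hf := (contDiffAt_extendZero f x).differentiableAt (by simp)
    have hg := (contDiffAt_extendZero g x).differentiableAt (by simp)
    change fderiv ℝ (extendZero (f + g : Smooth U)) (x : EuclideanSpace ℝ (Fin N)) _ =
      fderiv ℝ (extendZero f) (x : EuclideanSpace ℝ (Fin N)) _ +
      fderiv ℝ (extendZero g) (x : EuclideanSpace ℝ (Fin N)) _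
    rw [h.fderiv_eq, fderiv_add hf hg]
    rfl
  map_smul' c f := by
    ext x
    have h := eventuallyEq_of_restrict (g := extendZero (c • f : Smooth U))
      (h := c • extendZero f) (fun y => by simp [extendZero_apply]) x
    have hf := (contDiffAt_extendZero f x).differentiableAt (by simp)
    change fderiv ℝ (extendZero (c • f : Smooth U)) (x : EuclideanSpace ℝ (Fin N)) _ =
      c • fderiv ℝ (extendZero f) (x : EuclideanSpace ℝ (Fin N)) _
    rw [h.fderiv_eq, fderiv_const_smul hf]
    rfl

theorem partialU_apply (α : Fin N) (f : Smooth U) (x : U) :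
    partialU α f x = fderiv ℝ (extendZero f) (x : EuclideanSpace ℝ (Fin N))
      (EuclideanSpace.single α 1) := rfl

theorem partialU_comm (α β : Fin N) (f : Smooth U) :
    partialU α (partialU β f) = partialU β (partialU α f) := by
  ext x
  have key : ∀ α β : Fin N, partialU α (partialU β f) x =
      fderiv ℝ (fderiv ℝ (extendZero f)) (x : EuclideanSpace ℝ (Fin N))
        (EuclideanSpace.single α 1) (EuclideanSpace.single β 1) := by
    intro α β
    have h := eventuallyEq_of_restrict (g := extendZero (partialU β f))
      (h := fun y => fderiv ℝ (extendZero f) y (EuclideanSpace.single β 1))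
      (fun y => by rw [extendZero_apply, partialU_apply]) x
    have hf : DifferentiableAt ℝ (fderiv ℝ (extendZero f)) (x : EuclideanSpace ℝ (Fin N)) :=
      ((contDiffAt_extendZero f x).fderiv_right (m := 1)
        (by rw [one_add_one_eq_two]; exact WithTop.coe_le_coe.2 (le_top : (2 : ℕ∞) ≤ ⊤))).differentiableAt (by simp)
    rw [partialU_apply, h.fderiv_eq, fderiv_clm_apply hf (differentiableAt_const _)]
    simp
  rw [key, key]
  exact ((contDiffAt_extendZero f x).isSymmSndFDerivAt
    (by rw [minSmoothness_of_isRCLikeNormedField]; exact WithTop.coe_le_coe.2 (le_top : (2 : ℕ∞) ≤ ⊤))).eq _ _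

theorem partialU_algebraMap (α : Fin N) (c : ℝ) :
    partialU α (algebraMap ℝ (Smooth U) c) = 0 := by
  ext x
  have h := eventuallyEq_of_restrict (g := extendZero (algebraMap ℝ (Smooth U) c))
    (h := fun _ => c) (fun y => by rw [extendZero_apply]; rfl) x
  rw [partialU_apply, h.fderiv_eq]
  simp

end SmoothFunctions

/-! ### Jet variables, power series and the `θ` formalism -/

/-- The pairs `(α, S)`, with `α ∈ {1, …, N}` and a multi-index `S ∈ (ℤ_{≥ 0})^D`: they label the
variables `u^{α,S}` and `θ_α^S`. -/
abbrev Jet (N D : ℕ) : Type := Fin N × (Fin D → ℕ)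

/-- The pairs `(α, S)` with `|S| > 0`. -/
abbrev PosJet (N D : ℕ) : Type := {k : Jet N D // k.2 ≠ 0}

/-- `(α, S) ↦ (α, S + ξ_i)`. -/
def shift {N D : ℕ} (i : Fin D) (k : Jet N D) : Jet N D := (k.1, k.2 + Pi.single i 1)

/-- `(α, S) ↦ (α, S + ξ_i)`, as a pair with `|S + ξ_i| > 0`. -/
def shiftPos {N D : ℕ} (i : Fin D) (k : Jet N D) : PosJet N D :=
  ⟨shift i k, fun h => by simpa [shift] using congrFun h i⟩

/-- The algebra `C^∞(U)[[u^{α,S}, |S| > 0]]`. -/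
abbrev DiffSeries {N : ℕ} (U : TopologicalSpace.Opens (EuclideanSpace ℝ (Fin N))) (D : ℕ) : Type :=
  MvPowerSeries (PosJet N D) (Smooth U)

/-- The space `C^∞(U)[[{u^{α,S}, |S| > 0} ∪ {θ_α^S, |S| ≥ 0}]]` of formal power series in the
commuting variables `u^{α,S}` and the anticommuting variables `θ_α^S`. The series `f` stands for
the formal sum `∑_I f_I θ_I`, over the finite sets `I` of pairs `(α, S)`, where `θ_I` is the product
of the `θ_α^S`, `(α, S) ∈ I`, in increasing order with respect to the (lexicographic) linear
order `jetKey`. -/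
abbrev SuperSeries {N : ℕ} (U : TopologicalSpace.Opens (EuclideanSpace ℝ (Fin N))) (D : ℕ) : Type :=
  Finset (Jet N D) → DiffSeries U D

/-- The pair `(α, S)` in a linearly ordered set. -/
def jetKey {N D : ℕ} (k : Jet N D) : Fin N ×ₗ Lex (Fin D → ℕ) := toLex (k.1, toLex k.2)

/-- The sign `(-1)^{#{j ∈ I, j < k}}`, so that `θ_k θ_I = jetSign k I • θ_{I ∪ {k}}` for `k ∉ I`. -/
def jetSign {N D : ℕ} (k : Jet N D) (I : Finset (Jet N D)) : ℤ :=
  (-1) ^ (I.filter fun j => jetKey j < jetKey k).card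

section Operators

variable {N : ℕ} {U : TopologicalSpace.Opens (EuclideanSpace ℝ (Fin N))} {D : ℕ}

/-- `∂/∂u^α` on `C^∞(U)[[u^{α,S}, |S| > 0]]`: the partial derivative of every coefficient. -/
def derivU0 (α : Fin N) : DiffSeries U D →ₗ[ℝ] DiffSeries U D where
  toFun f := fun m => partialU α (MvPowerSeries.coeff m f)
  map_add' f g := by
    ext1 m
    exact (partialU α).map_add _ _
  map_smul' c f := by
    ext1 m
    exact (partialU α).map_smul c _

/-- `∂/∂u^{α,S}` on `C^∞(U)[[u^{α,S}, |S| > 0]]`, with `u^{α,0} = u^α`. -/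
def derivU (k : Jet N D) : DiffSeries U D →ₗ[ℝ] DiffSeries U D :=
  if h : k.2 = 0 then derivU0 k.1
  else (MvPowerSeries.pderiv (Smooth U) (⟨k, h⟩ : PosJet N D)).toLinearMap.restrictScalars ℝ

/-- `∂/∂u^{α,S}` on series in the `u` and `θ` variables. -/
def superDerivU (k : Jet N D) : SuperSeries U D →ₗ[ℝ] SuperSeries U D where
  toFun f := fun I => derivU k (f I)
  map_add' f g := by
    ext1 I
    exact (derivU k).map_add _ _
  map_smul' c f := by
    ext1 I
    exact (derivU k).map_smul c _

/-- Multiplication by `u^{α,S}`, `|S| > 0`. -/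
def mulU (k : PosJet N D) : SuperSeries U D →ₗ[ℝ] SuperSeries U D where
  toFun f := fun I => MvPowerSeries.X k * f I
  map_add' f g := by
    ext1 I
    exact mul_add _ _ _
  map_smul' c f := by
    ext1 I
    exact mul_smul_comm c (MvPowerSeries.X k) (f I)

/-- Left multiplication by `θ_α^S`. -/
def mulTheta (k : Jet N D) : SuperSeries U D →ₗ[ℝ] SuperSeries U D where
  toFun f := fun I => if k ∈ I then jetSign k I • f (I.erase k) else 0
  map_add' f g := by
    ext1 I
    by_cases h : k ∈ I <;> simp [h]
  map_smul' c f := by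
    ext1 I
    by_cases h : k ∈ I <;> simp [h]

/-- The (left) derivative `∂/∂θ_α^S`. -/
def derivTheta (k : Jet N D) : SuperSeries U D →ₗ[ℝ] SuperSeries U D where
  toFun f := fun I => if k ∈ I then 0 else jetSign k I • f (insert k I)
  map_add' f g := by
    ext1 I
    by_cases h : k ∈ I <;> simp [h]
  map_smul' c f := by
    ext1 I
    by_cases h : k ∈ I <;> simp [h]

/-- The operator `u^a ∂/∂u^b + θ^a ∂/∂θ^b`, for pairs `a = (α, S)` with `|S| > 0` and
`b = (β, T)`. -/
def gen (a : PosJet N D) (b : Jet N D) : SuperSeries U D →ₗ[ℝ] SuperSeries U D :=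
  mulU a ∘ₗ superDerivU b + mulTheta a.1 ∘ₗ derivTheta b

/-- The coefficient (a smooth function on `U`) of the monomial `u^m θ_I`. -/
def superCoeff (m : PosJet N D →₀ ℕ) (I : Finset (Jet N D)) : SuperSeries U D →ₗ[ℝ] Smooth U where
  toFun f := MvPowerSeries.coeff m (f I)
  map_add' _ _ := rfl
  map_smul' _ _ := rfl

theorem shift_injective (i : Fin D) : Function.Injective (shift (N := N) i) := by
  intro k l h
  simp only [shift, Prod.mk.injEq, add_left_inj] at h
  exact Prod.ext h.1 h.2

theorem shift_comm (i j : Fin D) (k : Jet N D) : shift i (shift j k) = shift j (shift i k) := by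
  simp only [shift, add_right_comm]

/-- The jet variables that occur in the monomial `u^m θ_I`. -/
def vars (m : PosJet N D →₀ ℕ) (I : Finset (Jet N D)) : Finset (Jet N D) :=
  m.support.image Subtype.val ∪ I

theorem superCoeff_gen_eq_zero {m : PosJet N D →₀ ℕ} {I : Finset (Jet N D)} {a : PosJet N D}
    (ha : a.1 ∉ vars m I) (b : Jet N D) (f : SuperSeries U D) :
    superCoeff m I (gen a b f) = 0 := by
  have h1 : a ∉ m.support := fun h => ha (Finset.mem_union_left _ (Finset.mem_image_of_mem _ h))
  have h2 : a.1 ∉ I := fun h => ha (Finset.mem_union_right _ h)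
  have h3 : ¬ Finsupp.single a 1 ≤ m := by
    intro h
    have := h a
    simp only [Finsupp.single_eq_same] at this
    exact h1 (Finsupp.mem_support_iff.2 (by omega))
  change MvPowerSeries.coeff m (MvPowerSeries.X a * derivU b (f I) +
    if a.1 ∈ I then _ else 0) = 0
  rw [if_neg h2, add_zero, MvPowerSeries.X_def, MvPowerSeries.coeff_monomial_mul, if_neg h3]

theorem finite_support_gen (i : Fin D) (m : PosJet N D →₀ ℕ) (I : Finset (Jet N D))
    (f : SuperSeries U D) :
    (Function.support fun k : Jet N D => superCoeff m I (gen (shiftPos i k) k f)).Finite := by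
  refine ((vars m I).finite_toSet.preimage (shift_injective i).injOn).subset ?_
  intro k hk
  by_contra h
  exact hk (superCoeff_gen_eq_zero (a := shiftPos i k) h k f)

/-- The total derivative
`∂_{x^i} = ∑_{α,S} (u^{α,S+ξ_i} ∂/∂u^{α,S} + θ_α^{S+ξ_i} ∂/∂θ_α^S)`. In the coefficient of a given
monomial only finitely many summands contribute (`finite_support_gen`). -/
def totalDeriv (i : Fin D) : SuperSeries U D →ₗ[ℝ] SuperSeries U D where
  toFun f := fun I m => ∑ᶠ k : Jet N D, superCoeff m I (gen (shiftPos i k) k f)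
  map_add' f g := by
    ext1 I
    ext1 m
    refine Eq.trans ?_ (finsum_add_distrib (finite_support_gen i m I f) (finite_support_gen i m I g))
    exact finsum_congr fun k => by rw [map_add, map_add]
  map_smul' c f := by
    ext1 I
    ext1 m
    refine Eq.trans ?_ (smul_finsum' c (finite_support_gen i m I f)).symm
    exact finsum_congr fun k => by rw [map_smul, map_smul]

theorem superCoeff_totalDeriv (i : Fin D) (m : PosJet N D →₀ ℕ) (I : Finset (Jet N D))
    (f : SuperSeries U D) :
    superCoeff m I (totalDeriv i f) = ∑ᶠ k : Jet N D, superCoeff m I (gen (shiftPos i k) k f) := rfl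

end Operators

section Commutation

variable {N : ℕ} {U : TopologicalSpace.Opens (EuclideanSpace ℝ (Fin N))} {D : ℕ}

theorem coeff_derivU0 (α : Fin N) (f : DiffSeries U D) (m : PosJet N D →₀ ℕ) :
    MvPowerSeries.coeff m (derivU0 α f) = partialU α (MvPowerSeries.coeff m f) := rfl

theorem derivU_of_eq {k : Jet N D} (h : k.2 = 0) (f : DiffSeries U D) :
    derivU k f = derivU0 k.1 f := by
  rw [derivU, dif_pos h]

theorem derivU_of_ne {k : Jet N D} (h : k.2 ≠ 0) (f : DiffSeries U D) :
    derivU k f = MvPowerSeries.pderiv (Smooth U) (⟨k, h⟩ : PosJet N D) f := by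
  rw [derivU, dif_neg h]; rfl

theorem partialU_mul_natCast (α : Fin N) (g : Smooth U) (n : ℕ) :
    partialU α (g * ((n : Smooth U) + 1)) = partialU α g * ((n : Smooth U) + 1) := by
  have h : ∀ x : Smooth U, x * ((n : Smooth U) + 1) = (n + 1) • x := by
    intro x
    rw [nsmul_eq_mul, mul_comm]; push_cast; rfl
  rw [h, h, map_nsmul]

theorem derivU_comm (a b : Jet N D) (f : DiffSeries U D) :
    derivU a (derivU b f) = derivU b (derivU a f) := by
  have mixed : ∀ (α : Fin N) (k : PosJet N D) (f : DiffSeries U D),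
      derivU0 α (MvPowerSeries.pderiv (Smooth U) k f) =
        MvPowerSeries.pderiv (Smooth U) k (derivU0 α f) := by
    intro α k f
    ext1 m
    rw [coeff_derivU0, MvPowerSeries.coeff_pderiv, MvPowerSeries.coeff_pderiv, coeff_derivU0,
      partialU_mul_natCast]
  by_cases ha : a.2 = 0 <;> by_cases hb : b.2 = 0
  · simp only [derivU_of_eq ha, derivU_of_eq hb]
    ext1 m
    simp only [coeff_derivU0, partialU_comm a.1 b.1]
  · simp only [derivU_of_eq ha, derivU_of_ne hb, mixed]
  · simp only [derivU_of_ne ha, derivU_of_eq hb, mixed]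
  · simp only [derivU_of_ne ha, derivU_of_ne hb]
    by_cases hab : a = b
    · subst hab; rfl
    have h1 : (⟨a, ha⟩ : PosJet N D) ≠ ⟨b, hb⟩ := fun h => hab (congrArg Subtype.val h)
    ext1 m
    simp only [MvPowerSeries.coeff_pderiv, Finsupp.add_apply, Finsupp.single_eq_of_ne h1,
      Finsupp.single_eq_of_ne h1.symm, add_zero, add_right_comm]
    ring

theorem derivU_X_mul (b : Jet N D) (a : PosJet N D) (f : DiffSeries U D) :
    derivU b (MvPowerSeries.X a * f) =
      (if b = a.1 then f else 0) + MvPowerSeries.X a * derivU b f := by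
  by_cases hb : b.2 = 0
  · have hne : b ≠ a.1 := fun h => a.2 (h ▸ hb)
    rw [if_neg hne, zero_add, derivU_of_eq hb, derivU_of_eq hb]
    ext1 m
    rw [coeff_derivU0, MvPowerSeries.X_def, MvPowerSeries.coeff_monomial_mul,
      MvPowerSeries.coeff_monomial_mul]
    split_ifs
    · rw [one_mul, one_mul, coeff_derivU0]
    · exact map_zero _
  · rw [derivU_of_ne hb, derivU_of_ne hb, Derivation.leibniz]
    by_cases h : b = a.1
    · have h' : a = (⟨b, hb⟩ : PosJet N D) := Subtype.ext h.symm
      rw [if_pos h, h', MvPowerSeries.pderiv_X_self]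
      simp only [smul_eq_mul, mul_one]
      ring
    · have h' : a ≠ (⟨b, hb⟩ : PosJet N D) := fun h' => h (congrArg Subtype.val h').symm
      rw [if_neg h, MvPowerSeries.pderiv_X_of_ne h']
      simp

theorem jetKey_injective : Function.Injective (jetKey (N := N) (D := D)) := by
  intro k l h
  simpa [jetKey, Prod.ext_iff] using h

theorem jetSign_erase_self (k : Jet N D) (I : Finset (Jet N D)) :
    jetSign k (I.erase k) = jetSign k I := by
  unfold jetSign
  congr 2
  ext j
  simp only [Finset.mem_filter, Finset.mem_erase]
  constructor
  · rintro ⟨⟨-, h⟩, h'⟩; exact ⟨h, h'⟩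
  · rintro ⟨h, h'⟩; exact ⟨⟨fun e => by simp [e] at h', h⟩, h'⟩

theorem jetSign_insert_self (k : Jet N D) (I : Finset (Jet N D)) :
    jetSign k (insert k I) = jetSign k I := by
  by_cases h : k ∈ I
  · rw [Finset.insert_eq_of_mem h]
  · rw [← jetSign_erase_self k (insert k I), Finset.erase_insert h]

theorem jetSign_mul_self (k : Jet N D) (I : Finset (Jet N D)) :
    jetSign k I * jetSign k I = 1 := by
  rw [jetSign, ← pow_add, ← two_mul, pow_mul]; norm_num

theorem jetSign_insert {k l : Jet N D} {I : Finset (Jet N D)} (h : l ∉ I) :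
    jetSign k (insert l I) = (if jetKey l < jetKey k then -1 else 1) * jetSign k I := by
  unfold jetSign
  rw [Finset.filter_insert]
  split_ifs with h'
  · rw [Finset.card_insert_of_notMem (fun e => h (Finset.mem_of_mem_filter _ e)), pow_succ]
    ring
  · ring

theorem jetSign_erase {k l : Jet N D} {I : Finset (Jet N D)} (h : l ∈ I) :
    jetSign k (I.erase l) = (if jetKey l < jetKey k then -1 else 1) * jetSign k I := by
  conv_rhs => rw [← Finset.insert_erase h, jetSign_insert (Finset.notMem_erase l I), ← mul_assoc]
  split_ifs <;> simp

theorem order_sign {k l : Jet N D} (h : k ≠ l) :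
    (if jetKey l < jetKey k then (-1 : ℤ) else 1) = - (if jetKey k < jetKey l then -1 else 1) := by
  rcases lt_or_gt_of_ne (jetKey_injective.ne h) with h' | h'
  · rw [if_pos h', if_neg h'.not_gt]; norm_num
  · rw [if_pos h', if_neg h'.not_gt]

theorem mulTheta_apply (k : Jet N D) (f : SuperSeries U D) (I : Finset (Jet N D)) :
    mulTheta k f I = if k ∈ I then jetSign k I • f (I.erase k) else 0 := rfl

theorem derivTheta_apply (k : Jet N D) (f : SuperSeries U D) (I : Finset (Jet N D)) :
    derivTheta k f I = if k ∈ I then 0 else jetSign k I • f (insert k I) := rfl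

/-- `θ_k θ_l + θ_l θ_k = 0`. -/
theorem mulTheta_anticomm (k l : Jet N D) (f : SuperSeries U D) :
    mulTheta k (mulTheta l f) = - mulTheta l (mulTheta k f) := by
  ext1 I
  by_cases hkl : k = l
  · subst hkl
    simp [mulTheta_apply]
  simp only [Pi.neg_apply, mulTheta_apply, Finset.mem_erase]
  by_cases hk : k ∈ I <;> by_cases hl : l ∈ I <;>
    simp only [hk, hl, hkl, Ne.symm hkl, ne_eq, not_false_eq_true, and_self, and_false, if_true,
      if_false, smul_zero, neg_zero]
  rw [jetSign_erase hk, jetSign_erase hl, Finset.erase_right_comm, smul_smul, smul_smul, ← neg_smul,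
    order_sign (Ne.symm hkl)]
  congr 1
  ring

/-- `∂/∂θ_k ∂/∂θ_l + ∂/∂θ_l ∂/∂θ_k = 0`. -/
theorem derivTheta_anticomm (k l : Jet N D) (f : SuperSeries U D) :
    derivTheta k (derivTheta l f) = - derivTheta l (derivTheta k f) := by
  ext1 I
  by_cases hkl : k = l
  · subst hkl
    simp [derivTheta_apply]
  simp only [Pi.neg_apply, derivTheta_apply, Finset.mem_insert]
  by_cases hk : k ∈ I <;> by_cases hl : l ∈ I <;>
    simp only [hk, hl, hkl, Ne.symm hkl, or_true, or_self, if_true,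
      if_false, smul_zero, neg_zero]
  rw [jetSign_insert hk, jetSign_insert hl, Finset.insert_comm, smul_smul, smul_smul, ← neg_smul,
    order_sign (Ne.symm hkl)]
  congr 1
  ring

/-- `∂/∂θ_k θ_l + θ_l ∂/∂θ_k = δ_{kl}`. -/
theorem derivTheta_mulTheta (k l : Jet N D) (f : SuperSeries U D) :
    derivTheta k (mulTheta l f) = (if k = l then f else 0) - mulTheta l (derivTheta k f) := by
  ext1 I
  by_cases hkl : k = l
  · subst hkl
    simp only [if_true, Pi.sub_apply, mulTheta_apply, derivTheta_apply, Finset.mem_insert_self,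
      Finset.notMem_erase, if_false]
    by_cases hk : k ∈ I
    · simp only [hk, if_true]
      rw [Finset.insert_erase hk, smul_smul, jetSign_erase_self, jetSign_mul_self, one_smul,
        sub_self]
    · simp only [hk, if_false]
      rw [Finset.erase_insert hk, smul_smul, jetSign_insert_self, jetSign_mul_self, one_smul,
        sub_zero]
  · simp only [hkl, if_false, Pi.sub_apply, Pi.zero_apply, zero_sub, mulTheta_apply,
      derivTheta_apply, Finset.mem_insert, Finset.mem_erase, Ne.symm hkl, false_or]
    by_cases hk : k ∈ I <;> by_cases hl : l ∈ I <;>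
      simp only [hk, hl, hkl, ne_eq, not_false_eq_true, and_self, and_false, if_true,
        if_false, smul_zero, neg_zero]
    rw [jetSign_insert hk, jetSign_erase hl, Finset.erase_insert_of_ne hkl, smul_smul,
      smul_smul, ← neg_smul, order_sign (Ne.symm hkl)]
    congr 1
    ring

theorem mulU_mulTheta (a : PosJet N D) (k : Jet N D) (f : SuperSeries U D) :
    mulU a (mulTheta k f) = mulTheta k (mulU a f) := by
  ext1 I
  change MvPowerSeries.X a * (if k ∈ I then jetSign k I • f (I.erase k) else 0) =
    if k ∈ I then jetSign k I • (MvPowerSeries.X a * f (I.erase k)) else 0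
  split_ifs
  · exact mul_smul_comm _ _ _
  · exact mul_zero _

theorem mulU_derivTheta (a : PosJet N D) (k : Jet N D) (f : SuperSeries U D) :
    mulU a (derivTheta k f) = derivTheta k (mulU a f) := by
  ext1 I
  change MvPowerSeries.X a * (if k ∈ I then 0 else jetSign k I • f (insert k I)) =
    if k ∈ I then 0 else jetSign k I • (MvPowerSeries.X a * f (insert k I))
  split_ifs
  · exact mul_zero _
  · exact mul_smul_comm _ _ _

theorem superDerivU_mulTheta (b : Jet N D) (k : Jet N D) (f : SuperSeries U D) :
    superDerivU b (mulTheta k f) = mulTheta k (superDerivU b f) := by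
  ext1 I
  change derivU b (if k ∈ I then jetSign k I • f (I.erase k) else 0) =
    if k ∈ I then jetSign k I • (derivU b (f (I.erase k))) else 0
  split_ifs
  · exact map_zsmul _ _ _
  · exact map_zero _

theorem superDerivU_derivTheta (b : Jet N D) (k : Jet N D) (f : SuperSeries U D) :
    superDerivU b (derivTheta k f) = derivTheta k (superDerivU b f) := by
  ext1 I
  change derivU b (if k ∈ I then 0 else jetSign k I • f (insert k I)) =
    if k ∈ I then 0 else jetSign k I • (derivU b (f (insert k I)))
  split_ifs
  · exact map_zero _
  · exact map_zsmul _ _ _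

theorem superDerivU_comm (a b : Jet N D) (f : SuperSeries U D) :
    superDerivU a (superDerivU b f) = superDerivU b (superDerivU a f) :=
  funext fun I => derivU_comm a b (f I)

theorem mulU_comm (a b : PosJet N D) (f : SuperSeries U D) :
    mulU a (mulU b f) = mulU b (mulU a f) :=
  funext fun I => mul_left_comm _ _ (f I)

theorem superDerivU_mulU (b : Jet N D) (a : PosJet N D) (f : SuperSeries U D) :
    superDerivU b (mulU a f) = (if b = a.1 then f else 0) + mulU a (superDerivU b f) := by
  ext1 I
  refine (derivU_X_mul b a (f I)).trans ?_
  split_ifs <;> rfl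

theorem gen_apply (a : PosJet N D) (b : Jet N D) (f : SuperSeries U D) :
    gen a b f = mulU a (superDerivU b f) + mulTheta a.1 (derivTheta b f) := rfl

theorem gen_commutator (a c : PosJet N D) (b d : Jet N D) (f : SuperSeries U D) :
    gen a b (gen c d f) - gen c d (gen a b f) =
      (if b = c.1 then gen a d f else 0) - (if d = a.1 then gen c b f else 0) := by
  have hU : mulU a (superDerivU b (mulU c (superDerivU d f))) -
      mulU c (superDerivU d (mulU a (superDerivU b f))) =
      (if b = c.1 then mulU a (superDerivU d f) else 0) -
      (if d = a.1 then mulU c (superDerivU b f) else 0) := by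
    rw [superDerivU_mulU, superDerivU_mulU, map_add, map_add, mulU_comm a c,
      superDerivU_comm b d]
    split_ifs <;> simp
  have hT : mulTheta a.1 (derivTheta b (mulTheta c.1 (derivTheta d f))) -
      mulTheta c.1 (derivTheta d (mulTheta a.1 (derivTheta b f))) =
      (if b = c.1 then mulTheta a.1 (derivTheta d f) else 0) -
      (if d = a.1 then mulTheta c.1 (derivTheta b f) else 0) := by
    rw [derivTheta_mulTheta, derivTheta_mulTheta, map_sub, map_sub, mulTheta_anticomm a.1 c.1,
      derivTheta_anticomm b d]
    split_ifs <;> simp only [map_neg, map_zero, neg_neg] <;> abel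
  have e1 : mulU a (superDerivU b (mulTheta c.1 (derivTheta d f))) =
      mulTheta c.1 (derivTheta d (mulU a (superDerivU b f))) := by
    rw [superDerivU_mulTheta, superDerivU_derivTheta, mulU_mulTheta, mulU_derivTheta]
  have e2 : mulU c (superDerivU d (mulTheta a.1 (derivTheta b f))) =
      mulTheta a.1 (derivTheta b (mulU c (superDerivU d f))) := by
    rw [superDerivU_mulTheta, superDerivU_derivTheta, mulU_mulTheta, mulU_derivTheta]
  have : gen a b (gen c d f) - gen c d (gen a b f) =
      (mulU a (superDerivU b (mulU c (superDerivU d f))) -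
        mulU c (superDerivU d (mulU a (superDerivU b f)))) +
      (mulTheta a.1 (derivTheta b (mulTheta c.1 (derivTheta d f))) -
        mulTheta c.1 (derivTheta d (mulTheta a.1 (derivTheta b f)))) := by
    simp only [gen_apply, map_add, e1, e2]
    abel
  rw [this, hU, hT]
  simp only [gen_apply]
  split_ifs <;> abel

/-- A coefficient of `gen a b g` only depends on finitely many coefficients of `g`. -/
theorem gen_local (a : PosJet N D) (b : Jet N D) (m : PosJet N D →₀ ℕ) (I : Finset (Jet N D)) :
    ∃ Y : Finset ((PosJet N D →₀ ℕ) × Finset (Jet N D)), ∀ g : SuperSeries U D,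
      (∀ y ∈ Y, superCoeff y.1 y.2 g = 0) → superCoeff m I (gen a b g) = 0 := by
  classical
  have hT : ∀ g : SuperSeries U D, superCoeff m (insert b (I.erase a.1)) g = 0 →
      superCoeff m I (mulTheta a.1 (derivTheta b g)) = 0 := by
    intro g hg
    change MvPowerSeries.coeff m (mulTheta a.1 (derivTheta b g) I) = 0
    rw [mulTheta_apply, derivTheta_apply]
    change MvPowerSeries.coeff m (g (insert b (I.erase a.1))) = 0 at hg
    split_ifs
    · rw [smul_zero, map_zero]
    · rw [map_zsmul, map_zsmul, hg, smul_zero, smul_zero]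
    · exact map_zero _
  have hU : ∃ n : PosJet N D →₀ ℕ, ∀ g : SuperSeries U D, superCoeff n I g = 0 →
      superCoeff m I (mulU a (superDerivU b g)) = 0 := by
    by_cases hb : b.2 = 0
    · refine ⟨m - Finsupp.single a 1, fun g hg => ?_⟩
      change MvPowerSeries.coeff m (MvPowerSeries.X a * derivU b (g I)) = 0
      change MvPowerSeries.coeff _ (g I) = 0 at hg
      rw [MvPowerSeries.X_def, MvPowerSeries.coeff_monomial_mul, derivU_of_eq hb, coeff_derivU0, hg,
        map_zero, mul_zero, ite_self]
    · refine ⟨m - Finsupp.single a 1 + Finsupp.single ⟨b, hb⟩ 1, fun g hg => ?_⟩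
      change MvPowerSeries.coeff m (MvPowerSeries.X a * derivU b (g I)) = 0
      change MvPowerSeries.coeff _ (g I) = 0 at hg
      rw [MvPowerSeries.X_def, MvPowerSeries.coeff_monomial_mul, derivU_of_ne hb,
        MvPowerSeries.coeff_pderiv, hg, zero_mul, mul_zero, ite_self]
  obtain ⟨n, hn⟩ := hU
  refine ⟨{(n, I), (m, insert b (I.erase a.1))}, fun g hg => ?_⟩
  rw [gen_apply, map_add, hn g (hg (n, I) (by simp)), hT g (hg (m, _) (by simp)), add_zero]

/-- Finite partial sums of the total derivative. -/
def partialTotalDeriv (i : Fin D) (W : Finset (Jet N D)) : SuperSeries U D →ₗ[ℝ] SuperSeries U D :=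
  ∑ k ∈ W, gen (shiftPos i k) k

theorem partialTotalDeriv_apply (i : Fin D) (W : Finset (Jet N D)) (f : SuperSeries U D) :
    partialTotalDeriv i W f = ∑ k ∈ W, gen (shiftPos i k) k f := by
  rw [partialTotalDeriv, LinearMap.sum_apply]

theorem superCoeff_totalDeriv_eq (i : Fin D) (m : PosJet N D →₀ ℕ) (I : Finset (Jet N D)) :
    ∃ W₀ : Finset (Jet N D), ∀ W, W₀ ⊆ W → ∀ f : SuperSeries U D,
      superCoeff m I (totalDeriv i f) = superCoeff m I (partialTotalDeriv i W f) := by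
  refine ⟨(vars m I).preimage (shift i) (shift_injective i).injOn, fun W hW f => ?_⟩
  rw [superCoeff_totalDeriv, partialTotalDeriv_apply, map_sum]
  refine finsum_eq_sum_of_support_subset _ fun k hk => hW (Finset.mem_preimage.2 ?_)
  by_contra h
  exact hk (superCoeff_gen_eq_zero (a := shiftPos i k) h k f)

theorem superCoeff_totalDeriv_totalDeriv (i j : Fin D) (m : PosJet N D →₀ ℕ)
    (I : Finset (Jet N D)) :
    ∃ W₀ : Finset (Jet N D), ∀ W, W₀ ⊆ W → ∀ f : SuperSeries U D,
      superCoeff m I (totalDeriv i (totalDeriv j f)) =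
        superCoeff m I (partialTotalDeriv i W (partialTotalDeriv j W f)) := by
  classical
  obtain ⟨W₁, hW₁⟩ := superCoeff_totalDeriv_eq (U := U) i m I
  choose Y hY using fun k : Jet N D => gen_local (U := U) (shiftPos i k) k m I
  choose V hV using fun y : (PosJet N D →₀ ℕ) × Finset (Jet N D) =>
    superCoeff_totalDeriv_eq (U := U) j y.1 y.2
  refine ⟨W₁ ∪ W₁.biUnion fun k => (Y k).biUnion V, fun W hW f => ?_⟩
  have h1 : W₁ ⊆ W := Finset.subset_union_left.trans hW
  rw [← hW₁ W h1, hW₁ W₁ subset_rfl, hW₁ W₁ subset_rfl, ← sub_eq_zero, ← map_sub, ← map_sub,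
    partialTotalDeriv_apply, map_sum]
  refine Finset.sum_eq_zero fun k hk => hY k _ fun y hy => ?_
  rw [map_sub, sub_eq_zero]
  refine hV y W (subset_trans ?_ hW) f
  exact (Finset.subset_biUnion_of_mem V hy).trans
    ((Finset.subset_biUnion_of_mem (fun k => (Y k).biUnion V) hk).trans Finset.subset_union_right)

/-- The total derivatives commute. -/
theorem totalDeriv_comm (i j : Fin D) (f : SuperSeries U D) :
    totalDeriv i (totalDeriv j f) = totalDeriv j (totalDeriv i f) := by
  classical
  ext1 I
  ext1 m
  change superCoeff m I (totalDeriv i (totalDeriv j f)) =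
    superCoeff m I (totalDeriv j (totalDeriv i f))
  obtain ⟨W₁, h₁⟩ := superCoeff_totalDeriv_totalDeriv (U := U) i j m I
  obtain ⟨W₂, h₂⟩ := superCoeff_totalDeriv_totalDeriv (U := U) j i m I
  let V : Finset (Jet N D) := (vars m I).preimage (fun l => shift i (shift j l))
    ((shift_injective i).comp (shift_injective j)).injOn
  let W := W₁ ∪ W₂ ∪ (V.image (shift i) ∪ V.image (shift j))
  have hV : ∀ l, l ∉ V → ∀ b, superCoeff m I (gen (shiftPos i (shift j l)) b f) = 0 :=
    fun l hl b => superCoeff_gen_eq_zero (a := shiftPos i (shift j l))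
      (fun h => hl (Finset.mem_preimage.2 h)) b f
  have hs : ∀ l : Jet N D, shiftPos j (shift i l) = shiftPos i (shift j l) :=
    fun l => Subtype.ext (shift_comm j i l)
  have hVi : ∀ l ∈ V, shift i l ∈ W := fun l hl =>
    Finset.mem_union_right _ (Finset.mem_union_left _ (Finset.mem_image_of_mem _ hl))
  have hVj : ∀ l ∈ V, shift j l ∈ W := fun l hl =>
    Finset.mem_union_right _ (Finset.mem_union_right _ (Finset.mem_image_of_mem _ hl))
  rw [h₁ W (fun x hx => by simp [W, hx]), h₂ W (fun x hx => by simp [W, hx]), ← sub_eq_zero,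
    ← map_sub]
  have expand : ∀ i j : Fin D, partialTotalDeriv i W (partialTotalDeriv j W f) =
      ∑ k ∈ W, ∑ l ∈ W, gen (shiftPos i k) k (gen (shiftPos j l) l f) := by
    intro i j
    rw [partialTotalDeriv_apply]
    exact Finset.sum_congr rfl fun k _ => by rw [partialTotalDeriv_apply, map_sum]
  rw [expand i j, expand j i, Finset.sum_comm (s := W) (t := W)
    (f := fun k l => gen (shiftPos j k) k (gen (shiftPos i l) l f)), ← Finset.sum_sub_distrib]
  have hc : ∀ (i : Fin D) (k : Jet N D), (shiftPos i k).1 = shift i k := fun _ _ => rfl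
  simp only [← Finset.sum_sub_distrib, gen_commutator, map_sum, hc]
  simp only [Finset.sum_sub_distrib, map_sub]
  rw [sub_eq_zero]
  rw [Finset.sum_comm]
  refine Finset.sum_congr rfl fun l hl => ?_
  by_cases h : l ∈ V
  · rw [Finset.sum_eq_single (shift j l), Finset.sum_eq_single (shift i l)]
    · rw [if_pos rfl, if_pos rfl, hs]
    · intro k _ hk
      rw [if_neg hk, map_zero]
    · exact fun h' => absurd (hVi l h) h'
    · intro k _ hk
      rw [if_neg hk, map_zero]
    · exact fun h' => absurd (hVj l h) h'
  · rw [Finset.sum_eq_zero, Finset.sum_eq_zero]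
    · intro k _
      split_ifs with e
      · rw [e, hs, hV l h]
      · exact map_zero _
    · intro k _
      split_ifs with e
      · rw [e]
        exact hV l h _
      · exact map_zero _

end Commutation

/-! ### The quotients `F̂_i` and the partial integration sequences -/

section Quotients

variable {N : ℕ} (U : TopologicalSpace.Opens (EuclideanSpace ℝ (Fin N))) {D : ℕ}

/-- The embedding of `ℝ` into the power series in `u` and `θ` as the constant series. -/
def constSeries (D : ℕ) : ℝ →ₗ[ℝ] SuperSeries U D :=
  LinearMap.single ℝ (fun _ : Finset (Jet N D) => DiffSeries U D) ∅ ∘ₗ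
    Algebra.linearMap ℝ (DiffSeries U D)

theorem constSeries_apply (c : ℝ) (I : Finset (Jet N D)) :
    constSeries U D c I = if I = ∅ then algebraMap ℝ (DiffSeries U D) c else 0 :=
  Pi.single_apply (M := DiffSeries U D) ∅ _ I

/-- The subspace `∂_{x^1} Â + ⋯ + ∂_{x^i} Â`. The directions are indexed by `Fin D`, starting from
`0`, so these are the first `i` of them. -/
def divergences (D i : ℕ) : Submodule ℝ (SuperSeries U D) :=
  ⨆ j : {j : Fin D // (j : ℕ) < i}, LinearMap.range (totalDeriv (U := U) j.1)

/-- The space `F̂_i = Â / (∂_{x^1} Â + ⋯ + ∂_{x^i} Â)`; in particular `F̂_0 = Â / 0 = Â`. -/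
abbrev FHat (D i : ℕ) : Type := SuperSeries U D ⧸ divergences U D i

/-- The image of `ℝ` in `F̂_i`. -/
def constants (D i : ℕ) : Submodule ℝ (FHat U D i) :=
  LinearMap.range ((divergences U D i).mkQ ∘ₗ constSeries U D)

theorem divergences_le_comap (a : Fin D) (i : ℕ) :
    divergences U D i ≤ (divergences U D i).comap (totalDeriv a) := by
  refine iSup_le fun j => ?_
  rintro _ ⟨g, rfl⟩
  rw [Submodule.mem_comap, totalDeriv_comm]
  exact Submodule.mem_iSup_of_mem j ⟨_, rfl⟩

theorem divergences_mono {i j : ℕ} (h : i ≤ j) : divergences U D i ≤ divergences U D j :=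
  iSup_le fun k => le_iSup (fun l : {l : Fin D // (l : ℕ) < j} =>
    LinearMap.range (totalDeriv (U := U) l.1)) ⟨k.1, k.2.trans_le h⟩

/-- The map induced on `F̂_i` by the total derivative in the direction `a`. -/
def totalDerivF (a : Fin D) (i : ℕ) : FHat U D i →ₗ[ℝ] FHat U D i :=
  (divergences U D i).mapQ (divergences U D i) (totalDeriv a) (divergences_le_comap U a i)

theorem totalDeriv_constSeries (a : Fin D) (c : ℝ) : totalDeriv a (constSeries U D c) = 0 := by
  classical
  ext1 I
  ext1 m
  change superCoeff m I (totalDeriv a (constSeries U D c)) = 0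
  rw [superCoeff_totalDeriv]
  refine finsum_eq_zero_of_forall_eq_zero fun k => ?_
  have hU : superDerivU k (constSeries U D c) = 0 := by
    ext1 J
    change derivU k (constSeries U D c J) = 0
    rw [constSeries_apply]
    split_ifs
    · rw [MvPowerSeries.algebraMap_apply]
      by_cases hk : k.2 = 0
      · rw [derivU_of_eq hk]
        ext1 n
        rw [coeff_derivU0, MvPowerSeries.coeff_C]
        split_ifs
        · exact partialU_algebraMap _ _
        · exact map_zero _
      · rw [derivU_of_ne hk, MvPowerSeries.pderiv_C]
    · exact map_zero _
  have hT : derivTheta k (constSeries U D c) = 0 := by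
    ext1 J
    rw [derivTheta_apply, constSeries_apply, if_neg (Finset.insert_ne_empty k J), smul_zero,
      ite_self]
    rfl
  rw [gen_apply, hU, hT, map_zero, map_zero, add_zero, map_zero]

theorem constants_le_ker (a : Fin D) (i : ℕ) :
    constants U D i ≤ LinearMap.ker (totalDerivF U a i) := by
  rintro _ ⟨c, rfl⟩
  rw [LinearMap.mem_ker]
  change (divergences U D i).mkQ (totalDeriv a (constSeries U D c)) = 0
  rw [totalDeriv_constSeries, map_zero]

/-- The first map `F̂_i / ℝ → F̂_i` of the partial integration sequence, induced by the total
derivative in the direction `a`. -/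
def totalDerivModConst (a : Fin D) (i : ℕ) : (FHat U D i ⧸ constants U D i) →ₗ[ℝ] FHat U D i :=
  (constants U D i).liftQ (totalDerivF U a i) (constants_le_ker U a i)

/-- The partial integration `F̂_i → F̂_{i+1}`: the projection to the quotient. -/
def partialIntegral (D i : ℕ) : FHat U D i →ₗ[ℝ] FHat U D (i + 1) :=
  Submodule.factor (divergences_mono U (Nat.le_succ i))

end Quotients

end JetCalculus

end

noncomputable section

namespace JetCalculus

/-! ### The Euler operator on smooth functions on a ball -/

section Radial

variable {E : Type*} [NormedAddCommGroup E] [NormedSpace ℝ E]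

/-! Surjectivity is formal, and so is exactness in the middle, because the divergences in one more
direction are the old ones plus the image of `∂_{x^a}`. The content is that the kernel of `∂_{x^a}`
on the quotient is `ℝ`: if `∂_{x^a} f` is a sum of divergences in the directions before `a`, then so
is `f`, up to a constant.

This is proved with an operator `H` satisfying two properties: `H ∂_{x^a} f` differs from `f` by a
constant, and `H` commutes with `∂_{x^j}` for `j ≠ a`. Then `H (∂_{x^a} f)` is again a sum of
divergences in the earlier directions.

To build `H`, differentiate `f` in all variables. The relation `[∂/∂u^{α,S}, ∂_{x^i}] =
∂/∂u^{α,S-ξ_i}` (zero if `S_i = 0`), and its analogue for `θ`, say that the vertical differential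
turns `∂_{x^i}` into the operator `lieDeriv i : w_k ↦ ∂_{x^i} w_k + w_{k-ξ_i}`. Unlike `∂_{x^a}`,
this has a left inverse, the telescoping series `∑_t (-∂_{x^a})^t w_{k+(t+1)ξ_a}`. It converges
coefficientwise because every `∂_{x^a}` adds one derivative in the direction `a`
(`lieDerivInv_lieDeriv`, `lieDerivInv_lieDeriv_of_ne`).

To return from one-forms to series, contract with the Euler vector field centred at `c`. Contraction
of `df` gives the Euler operator `E f` (`eulerOp_eq_contract`) and intertwines `lieDeriv i` with
`∂_{x^i}`, so `E` commutes with all `∂_{x^i}`. Since `E X_k = X_k (E + 1)`, inserting `R = (E +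
1)⁻¹` before contracting gives `E H ∂_{x^a} f = E f` (`euler_antiTotalDeriv`).

The ball enters twice, both times by integration along rays from its centre: `E + 1` is bijective
(`bijective_eulerOp_add_id`), and the kernel of `E` is `ℝ`
(`mem_range_constSeries_of_eulerOp_eq_zero`). -/

theorem contDiff_integral_zero_one {F : E × ℝ → ℝ} (hF : ContDiff ℝ ∞ F) :
    ContDiff ℝ ∞ fun x => ∫ t in (0 : ℝ)..1, F (x, t) := by
  -- The integral is the value at `0` of the convolution of the indicator of `(0, 1]` with `s ↦ F
  -- (x, -s)`. Smoothness with parameters needs compact support in `s`, so `F` is cut off by a bump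
  -- equal to `1` on `[-1, 1]`.
  let χ : ContDiffBump (0 : ℝ) := ⟨1, 2, one_pos, one_lt_two⟩
  let f : ℝ → ℝ := (Set.Ioc (0 : ℝ) 1).indicator 1
  let g : E → ℝ → ℝ := fun p s => χ s * F (p, -s)
  have hf : MeasureTheory.LocallyIntegrable f MeasureTheory.volume := by
    refine (MeasureTheory.IntegrableOn.integrable_indicator ?_ measurableSet_Ioc).locallyIntegrable
    exact MeasureTheory.integrableOn_const (by simp)
  have hg : ContDiff ℝ ∞ (Function.uncurry g) :=
    (χ.contDiff.comp contDiff_snd).mul (hF.comp (contDiff_fst.prodMk contDiff_snd.neg))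
  have key := MeasureTheory.contDiffOn_convolution_right_with_param
    (μ := MeasureTheory.volume) (n := ⊤)
    (ContinuousLinearMap.mul ℝ ℝ) (g := g) (s := Set.univ) (k := Metric.closedBall (0 : ℝ) 2)
    isOpen_univ (isCompact_closedBall _ _) (fun p x _ hx => by
      have : χ x = 0 := χ.zero_of_le_dist (by
        simpa using (not_le.1 (fun h => hx (Metric.mem_closedBall.2 h))).le)
      simp [g, this]) hf hg.contDiffOn
  have h0 : ContDiff ℝ ∞ fun p : E => (p, (0 : ℝ)) := contDiff_id.prodMk contDiff_const
  have := (key.comp h0.contDiffOn (s := Set.univ) (fun _ _ => by simp))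
  rw [contDiffOn_univ] at this
  convert this using 2 with p
  rw [intervalIntegral.integral_of_le zero_le_one]
  simp only [Function.comp, MeasureTheory.convolution, ContinuousLinearMap.mul_apply', g, f]
  rw [← MeasureTheory.integral_indicator measurableSet_Ioc]
  congr 1
  ext t
  by_cases ht : t ∈ Set.Ioc (0 : ℝ) 1
  · have : χ (0 - t) = 1 := χ.one_of_mem_closedBall (by
      simp only [χ, zero_sub, Metric.mem_closedBall, dist_zero_right, norm_neg, Real.norm_eq_abs]
      rw [abs_of_pos ht.1]; exact ht.2)
    rw [Set.indicator_of_mem ht, Set.indicator_of_mem ht, this]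
    simp
  · rw [Set.indicator_of_notMem ht, Set.indicator_of_notMem ht, zero_mul]

theorem add_smul_sub_mem_ball {c x : E} {r t : ℝ} (hx : x ∈ Metric.ball c r) (h0 : 0 ≤ t)
    (h1 : t ≤ 1) : c + t • (x - c) ∈ Metric.ball c r := by
  rw [mem_ball_iff_norm] at hx ⊢
  rw [add_sub_cancel_left, norm_smul, Real.norm_of_nonneg h0]
  exact (mul_le_of_le_one_left (norm_nonneg _) h1).trans_lt hx

/-- The weighted radial average `x ↦ ∫₀¹ t^n g(c + t (x - c)) dt`. -/
def radialAverage (c : E) (n : ℕ) (g : E → ℝ) (x : E) : ℝ :=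
  ∫ t in (0 : ℝ)..1, t ^ n * g (c + t • (x - c))

/-- Near `x`, only the values of `g` on a smaller concentric ball matter, since it contains the
segments to `c`. So `g` may be replaced by a globally smooth function `χ g`, to which
`contDiff_integral_zero_one` applies. -/
theorem contDiffAt_radialAverage [HasContDiffBump E] [FiniteDimensional ℝ E] {c : E} {r : ℝ}
    {g : E → ℝ}
    (hg : ∀ x ∈ Metric.ball c r, ContDiffAt ℝ ∞ g x) (n : ℕ) {x : E} (hx : x ∈ Metric.ball c r) :
    ContDiffAt ℝ ∞ (radialAverage c n g) x := by
  have hr : 0 < r := Metric.pos_of_mem_ball hx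
  -- Radii with `dist x c < ρ < σ < r`: the bump is `1` on the ball of radius `ρ` and vanishes
  -- outside the one of radius `σ`.
  obtain ⟨ρ, hρ, hρr⟩ := exists_between (max_lt hr (Metric.mem_ball.1 hx))
  have hρ0 : 0 < ρ := (le_max_left _ _).trans_lt hρ
  obtain ⟨σ, hσ, hσr⟩ := exists_between hρr
  let χ : ContDiffBump c := ⟨ρ, σ, hρ0, hσ⟩
  have hG : ContDiff ℝ ∞ fun y => χ y * g y := by
    refine contDiff_iff_contDiffAt.2 fun y => ?_
    by_cases hy : y ∈ Metric.ball c r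
    · exact χ.contDiffAt.mul (hg y hy)
    · have hy' : ∀ᶠ z in nhds y, z ∉ Metric.closedBall c σ :=
        Metric.isClosed_closedBall.isOpen_compl.mem_nhds
          (fun h => hy (Metric.closedBall_subset_ball hσr h))
      refine (contDiffAt_const (c := (0 : ℝ))).congr_of_eventuallyEq ?_
      filter_upwards [hy'] with z hz
      rw [χ.zero_of_le_dist (not_le.1 fun h => hz (Metric.mem_closedBall.2 h)).le, zero_mul]
  have hF := contDiff_integral_zero_one (F := fun q : E × ℝ =>
    q.2 ^ n * (χ (c + q.2 • (q.1 - c)) * g (c + q.2 • (q.1 - c))))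
    ((contDiff_snd.pow n).mul (hG.comp
      (contDiff_const.add (contDiff_snd.smul (contDiff_fst.sub contDiff_const)))))
  refine hF.contDiffAt.congr_of_eventuallyEq ?_
  have hxρ : x ∈ Metric.ball c ρ := Metric.mem_ball.2 ((le_max_right _ _).trans_lt hρ)
  filter_upwards [Metric.isOpen_ball.mem_nhds hxρ] with y hy
  refine intervalIntegral.integral_congr fun t ht => ?_
  rw [Set.uIcc_of_le zero_le_one] at ht
  have := χ.one_of_mem_closedBall (x := c + t • (y - c))
    (Metric.ball_subset_closedBall (add_smul_sub_mem_ball hy ht.1 ht.2))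
  simp only [this, one_mul]

theorem hasDerivAt_add_smul_sub (c x : E) (t : ℝ) :
    HasDerivAt (fun s : ℝ => c + s • (x - c)) (x - c) t := by
  simpa using ((hasDerivAt_id t).smul_const (x - c)).const_add c

/-- Rescaling `t` gives `s^{n+1} A(c + s(x - c)) = ∫₀ˢ t^n g(c + t(x - c)) dt` for the average `A`.
Comparing the two derivatives at `s = 1`, by the product rule and by the fundamental theorem of
calculus, yields the Euler equation. -/
theorem fderiv_radialAverage [HasContDiffBump E] [FiniteDimensional ℝ E] {c : E} {r : ℝ}
    {g : E → ℝ}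
    (hg : ∀ x ∈ Metric.ball c r, ContDiffAt ℝ ∞ g x) (n : ℕ) {x : E} (hx : x ∈ Metric.ball c r) :
    fderiv ℝ (radialAverage c n g) x (x - c) + (n + 1) * radialAverage c n g x = g x := by
  have hdiff := (contDiffAt_radialAverage hg n hx).differentiableAt (by simp)
  have hline : c + (1 : ℝ) • (x - c) = x := by simp
  have h1 : HasDerivAt (fun s : ℝ => s ^ (n + 1) * radialAverage c n g (c + s • (x - c)))
      ((n + 1) * radialAverage c n g x + fderiv ℝ (radialAverage c n g) x (x - c)) 1 := by
    have h := HasFDerivAt.comp_hasDerivAt (x := (1 : ℝ)) (f := fun s : ℝ => c + s • (x - c))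
      (l := radialAverage c n g) (l' := fderiv ℝ (radialAverage c n g) x) (f' := x - c)
      (by rw [hline]; exact hdiff.hasFDerivAt) (hasDerivAt_add_smul_sub c x 1)
    refine ((hasDerivAt_pow (n + 1) (1 : ℝ)).mul h).congr_deriv ?_
    simp only [Function.comp_apply, hline]
    simp
  have h2 : (fun s : ℝ => s ^ (n + 1) * radialAverage c n g (c + s • (x - c))) =
      fun s => ∫ t in (0 : ℝ)..s, t ^ n * g (c + t • (x - c)) := by
    ext s
    have := intervalIntegral.smul_integral_comp_mul_right (a := 0) (b := 1)
      (fun t : ℝ => t ^ n * g (c + t • (x - c))) s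
    rw [zero_mul, one_mul] at this
    rw [← this, radialAverage, smul_eq_mul, pow_succ', mul_assoc,
      ← intervalIntegral.integral_const_mul]
    congr 1
    refine intervalIntegral.integral_congr fun t _ => ?_
    simp only [add_sub_cancel_left, smul_smul, mul_pow]
    ring
  have hopen : IsOpen {s : ℝ | c + s • (x - c) ∈ Metric.ball c r} :=
    Metric.isOpen_ball.preimage (by fun_prop)
  have hcont : ContinuousOn (fun t : ℝ => t ^ n * g (c + t • (x - c)))
      {s : ℝ | c + s • (x - c) ∈ Metric.ball c r} := by
    refine ((continuous_pow n).continuousOn).mul fun t ht => ?_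
    exact (ContinuousAt.comp (f := fun s : ℝ => c + s • (x - c)) (hg _ ht).continuousAt
      (by fun_prop)).continuousWithinAt
  have hmem : (1 : ℝ) ∈ {s : ℝ | c + s • (x - c) ∈ Metric.ball c r} := by
    simpa only [Set.mem_ofPred_eq, hline] using hx
  have h3 := intervalIntegral.integral_hasDerivAt_right (a := 0) (b := (1 : ℝ))
    (f := fun t : ℝ => t ^ n * g (c + t • (x - c)))
    (hcont.mono (by
      intro t ht
      rw [Set.uIcc_of_le zero_le_one] at ht
      exact add_smul_sub_mem_ball hx ht.1 ht.2)).intervalIntegrable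
    (hcont.stronglyMeasurableAtFilter hopen 1 hmem) (hcont.continuousAt (hopen.mem_nhds hmem))
  rw [← h2] at h3
  have := h1.unique h3
  simp only [one_pow, one_mul, hline] at this
  rw [← this, add_comm]

/-- The equation makes `s^n h(c + s(x - c))` constant along the ray, so its values at `s = 1` and `s
= 0` agree. With `0 ^ 0 = 1` this covers both cases: `h` is constant for `n = 0` and vanishes for `n
> 0`. -/
theorem eq_of_euler_eq_zero {c : E} {r : ℝ} {h : E → ℝ}
    (hh : ∀ x ∈ Metric.ball c r, DifferentiableAt ℝ h x) (n : ℕ)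
    (hE : ∀ x ∈ Metric.ball c r, fderiv ℝ h x (x - c) + n * h x = 0) {x : E}
    (hx : x ∈ Metric.ball c r) : h x = 0 ^ n * h c := by
  have hd : ∀ t : ℝ, 0 ≤ t → t ≤ 1 → HasDerivAt (fun s : ℝ => s ^ n * h (c + s • (x - c)))
      (n * t ^ (n - 1) * h (c + t • (x - c)) + t ^ n * fderiv ℝ h (c + t • (x - c)) (x - c)) t :=
    fun t h0 h1 => (hasDerivAt_pow n t).mul (HasFDerivAt.comp_hasDerivAt (x := t)
      (f := fun s : ℝ => c + s • (x - c))
      (hh _ (add_smul_sub_mem_ball hx h0 h1)).hasFDerivAt (hasDerivAt_add_smul_sub c x t))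
  obtain ⟨t, ht, hs⟩ := exists_hasDerivAt_eq_slope _ _ (zero_lt_one (α := ℝ))
    (fun t ht => (hd t ht.1 ht.2).continuousAt.continuousWithinAt)
    (fun t ht => hd t ht.1.le ht.2.le)
  have h0 := hE _ (add_smul_sub_mem_ball hx ht.1.le ht.2.le)
  rw [add_sub_cancel_left, map_smul, smul_eq_mul] at h0
  -- At the mean value point, `t` times the derivative is `t^n` times the Euler equation at `c + t(x
  -- - c)`; the factor `t ≠ 0` is cancelled afterwards. It also absorbs the truncated exponent `n -
  -- 1`.
  have hz : t * (n * t ^ (n - 1) * h (c + t • (x - c)) +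
      t ^ n * fderiv ℝ h (c + t • (x - c)) (x - c)) = 0 := by
    have hn : (n : ℝ) * t ^ (n - 1) * t = n * t ^ n := by
      cases n with
      | zero => simp
      | succ n => rw [Nat.add_sub_cancel, mul_assoc, ← pow_succ]
    linear_combination t ^ n * h0 + h (c + t • (x - c)) * hn
  rw [(mul_eq_zero.1 hz).resolve_left ht.1.ne'] at hs
  simp only [one_pow, one_smul, add_sub_cancel, zero_smul, add_zero, sub_zero, div_one,
    one_mul] at hs
  linarith

end Radial

/-! ### The Euler operator as an operator on `C^∞(U)` -/

section EulerSmooth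

variable {N : ℕ} {U : TopologicalSpace.Opens (EuclideanSpace ℝ (Fin N))}

/-- The function `u^α - c^α`. -/
def centeredCoord (U : TopologicalSpace.Opens (EuclideanSpace ℝ (Fin N)))
    (c : EuclideanSpace ℝ (Fin N)) (α : Fin N) : Smooth U :=
  ⟨fun x => (x : EuclideanSpace ℝ (Fin N)) α - c α, by
    have h : ContDiff ℝ ∞ fun y : EuclideanSpace ℝ (Fin N) => y α - c α := by fun_prop
    exact h.contMDiff.comp contMDiff_subtype_val⟩

theorem partialU_mul (α : Fin N) (f g : Smooth U) :
    partialU α (f * g) = f * partialU α g + partialU α f * g := by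
  ext x
  have h := eventuallyEq_of_restrict (g := extendZero (f * g : Smooth U))
    (h := fun y => extendZero f y * extendZero g y) (fun y => by simp [extendZero_apply]) x
  have hf := (contDiffAt_extendZero f x).differentiableAt (by simp)
  have hg := (contDiffAt_extendZero g x).differentiableAt (by simp)
  rw [partialU_apply, h.fderiv_eq, fderiv_fun_mul hf hg]
  simp [extendZero_apply, partialU_apply, mul_comm]

theorem partialU_centeredCoord (c : EuclideanSpace ℝ (Fin N)) (α β : Fin N) :
    partialU α (centeredCoord U c β) = if α = β then 1 else 0 := by
  ext x
  have h := eventuallyEq_of_restrict (g := extendZero (centeredCoord U c β))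
    (h := fun y => EuclideanSpace.proj (𝕜 := ℝ) β y - c β)
    (fun y => by rw [extendZero_apply]; rfl) x
  rw [partialU_apply, h.fderiv_eq, fderiv_sub_const, ContinuousLinearMap.fderiv]
  by_cases hab : α = β
  · subst hab; simp
  · simp [hab, Ne.symm hab]

/-- The Euler operator `∑_α (u^α - c^α) ∂/∂u^α`. -/
def eulerSmooth (c : EuclideanSpace ℝ (Fin N)) : Smooth U →ₗ[ℝ] Smooth U :=
  ∑ α, LinearMap.mulLeft ℝ (centeredCoord U c α) ∘ₗ partialU α

theorem eulerSmooth_eq_sum (c : EuclideanSpace ℝ (Fin N)) (f : Smooth U) :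
    eulerSmooth c f = ∑ α, centeredCoord U c α * partialU α f := by
  simp [eulerSmooth, LinearMap.sum_apply]

theorem eulerSmooth_centeredCoord_mul (c : EuclideanSpace ℝ (Fin N)) (α : Fin N) (f : Smooth U) :
    eulerSmooth c (centeredCoord U c α * f) =
      centeredCoord U c α * (eulerSmooth c f + f) := by
  have : ∀ β, centeredCoord U c β * partialU β (centeredCoord U c α * f) =
      centeredCoord U c α * (centeredCoord U c β * partialU β f) +
        if β = α then centeredCoord U c α * f else 0 := by
    intro β
    rw [partialU_mul, partialU_centeredCoord]
    split_ifs with h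
    · subst h; ring
    · ring
  simp only [eulerSmooth_eq_sum, this, Finset.sum_add_distrib, ← Finset.mul_sum]
  simp [mul_add]

theorem smooth_add_nsmul_apply (f g : Smooth U) (n : ℕ) (x : U) :
    (f + n • g) x = f x + n * g x := by
  rw [← Nat.cast_smul_eq_nsmul ℝ n g]
  rfl

theorem eulerSmooth_apply (c : EuclideanSpace ℝ (Fin N)) (f : Smooth U) (x : U) :
    eulerSmooth c f x = fderiv ℝ (extendZero f) (x : EuclideanSpace ℝ (Fin N)) (x - c) := by
  have hx : (x : EuclideanSpace ℝ (Fin N)) - c =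
      ∑ α, ((x : EuclideanSpace ℝ (Fin N)) α - c α) • EuclideanSpace.single α (1 : ℝ) := by
    ext β
    simp [Finset.sum_apply, Pi.single_apply]
  have hsum : ∀ s : Finset (Fin N), (∑ α ∈ s, centeredCoord U c α * partialU α f) x =
      ∑ α ∈ s, centeredCoord U c α x * partialU α f x := by
    intro s
    induction s using Finset.induction_on with
    | empty => simp
    | insert a s ha ih => rw [Finset.sum_insert ha, Finset.sum_insert ha, ← ih]; rfl
  rw [eulerSmooth_eq_sum, hsum, hx, map_sum]
  simp only [map_smul, smul_eq_mul]
  rfl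

variable {c : EuclideanSpace ℝ (Fin N)} {r : ℝ}

theorem eq_of_eulerSmooth_add_nsmul_eq_zero
    (hU : (U : Set (EuclideanSpace ℝ (Fin N))) = Metric.ball c r) (n : ℕ) {f : Smooth U}
    (hf : eulerSmooth c f + n • f = 0) (x : U) : f x = 0 ^ n * extendZero f c := by
  have hmem : ∀ {y}, y ∈ Metric.ball c r → y ∈ U := fun {y} hy => by
    rw [← hU] at hy; exact hy
  rw [← extendZero_apply f x]
  refine eq_of_euler_eq_zero (c := c) (r := r)
    (fun y hy => (contDiffAt_extendZero f ⟨y, hmem hy⟩).differentiableAt (by simp)) n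
    (fun y hy => ?_) (by rw [← hU]; exact x.2)
  have := congrArg (fun g : Smooth U => g ⟨y, hmem hy⟩) hf
  simp only [smooth_add_nsmul_apply, eulerSmooth_apply] at this
  rw [← extendZero_apply f ⟨y, hmem hy⟩] at this
  exact this

theorem exists_eulerSmooth_add_nsmul_eq
    (hU : (U : Set (EuclideanSpace ℝ (Fin N))) = Metric.ball c r) (n : ℕ) (g : Smooth U) :
    ∃ f : Smooth U, eulerSmooth c f + (n + 1) • f = g := by
  have hmem : ∀ {y}, y ∈ Metric.ball c r → y ∈ U := fun {y} hy => by
    rw [← hU] at hy; exact hy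
  have hmem' : ∀ y : U, (y : EuclideanSpace ℝ (Fin N)) ∈ Metric.ball c r := fun y => by
    rw [← hU]; exact y.2
  have hg : ∀ y ∈ Metric.ball c r, ContDiffAt ℝ ∞ (extendZero g) y :=
    fun y hy => contDiffAt_extendZero g ⟨y, hmem hy⟩
  let f : Smooth U := ⟨fun x => radialAverage c n (extendZero g) x, fun x =>
    contMDiffAt_subtype_iff.2
      (contMDiffAt_iff_contDiffAt.2 (contDiffAt_radialAverage hg n (hmem' x)))⟩
  refine ⟨f, ?_⟩
  ext x
  have h := eventuallyEq_of_restrict (g := extendZero f)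
    (h := radialAverage c n (extendZero g)) (fun y => by rw [extendZero_apply]; rfl) x
  rw [smooth_add_nsmul_apply, Nat.cast_succ, eulerSmooth_apply, h.fderiv_eq, ← extendZero_apply g x,
    ← fderiv_radialAverage hg n (hmem' x)]
  rfl

/-- The shift has to be positive: for shift `0` the constants are in the kernel. This is why the
homotopy uses the inverse of `E + 1` rather than of `E`. -/
theorem bijective_eulerSmooth_add_nsmul
    (hU : (U : Set (EuclideanSpace ℝ (Fin N))) = Metric.ball c r) (n : ℕ) :
    Function.Bijective fun f : Smooth U => eulerSmooth c f + (n + 1) • f := by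
  refine ⟨fun f g hfg => ?_, exists_eulerSmooth_add_nsmul_eq hU n⟩
  have h : eulerSmooth c (f - g) + (n + 1) • (f - g) = 0 := by
    rw [map_sub, smul_sub]
    exact (sub_add_sub_comm _ _ _ _).trans (sub_eq_zero.2 hfg)
  refine sub_eq_zero.1 ?_
  ext x
  rw [eq_of_eulerSmooth_add_nsmul_eq_zero hU _ h x]
  simp

end EulerSmooth

/-! ### The topology of coefficientwise stabilization -/

section Topology

open scoped MvPowerSeries.WithPiTopology

variable {N : ℕ} {U : TopologicalSpace.Opens (EuclideanSpace ℝ (Fin N))} {D : ℕ}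

/-- The discrete topology on the coefficients; it makes a family of series summable when every
coefficient receives finitely many contributions. -/
abbrev smoothDiscreteTopology : TopologicalSpace (Smooth U) := ⊥

attribute [local instance] smoothDiscreteTopology

theorem smooth_discreteTopology : DiscreteTopology (Smooth U) := ⟨rfl⟩

attribute [local instance] smooth_discreteTopology

theorem superSeries_ext {f g : SuperSeries U D}
    (h : ∀ m I, superCoeff m I f = superCoeff m I g) : f = g :=
  funext fun I => MvPowerSeries.ext fun m => h m I

theorem continuous_superCoeff (m : PosJet N D →₀ ℕ) (I : Finset (Jet N D)) :
    Continuous (superCoeff m I : SuperSeries U D → Smooth U) :=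
  (MvPowerSeries.WithPiTopology.continuous_coeff (Smooth U) m).comp (continuous_apply I)

theorem continuous_superSeries_iff {Y : Type*} [TopologicalSpace Y] {T : Y → SuperSeries U D} :
    Continuous T ↔ ∀ m I, Continuous fun y => superCoeff m I (T y) :=
  ⟨fun h m I => (continuous_superCoeff m I).comp h,
    fun h => continuous_pi fun I => continuous_pi fun m => h m I⟩

theorem continuous_comp_superCoeff {β : Type*} [TopologicalSpace β] (φ : Smooth U → β)
    (m : PosJet N D →₀ ℕ) (I : Finset (Jet N D)) :
    Continuous fun f : SuperSeries U D => φ (superCoeff m I f) :=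
  continuous_of_discreteTopology.comp (continuous_superCoeff m I)

theorem hasSum_superSeries_iff {ι : Type*} {F : ι → SuperSeries U D} {s : SuperSeries U D} :
    HasSum F s ↔ ∀ m I, HasSum (fun k => superCoeff m I (F k)) (superCoeff m I s) := by
  rw [Pi.hasSum, forall_comm]
  exact forall_congr' fun I => MvPowerSeries.WithPiTopology.hasSum_iff_hasSum_coeff

/-- With discrete coefficients, finite support in every coefficient is enough for convergence; this
replaces all estimates. -/
theorem summable_superSeries {ι : Type*} {F : ι → SuperSeries U D}
    (h : ∀ m I, (Function.support fun k => superCoeff m I (F k)).Finite) : Summable F :=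
  ⟨fun I m => ∑' k, superCoeff m I (F k), hasSum_superSeries_iff.2 fun m I =>
    (summable_of_hasFiniteSupport (h m I)).hasSum⟩

/-! ### Coefficients and continuity of the elementary operators -/

theorem superCoeff_mulU (a : PosJet N D) (m : PosJet N D →₀ ℕ) (I : Finset (Jet N D))
    (f : SuperSeries U D) :
    superCoeff m I (mulU a f) =
      if Finsupp.single a 1 ≤ m then superCoeff (m - Finsupp.single a 1) I f else 0 := by
  change MvPowerSeries.coeff m (MvPowerSeries.X a * f I) = _
  rw [MvPowerSeries.X_def, MvPowerSeries.coeff_monomial_mul]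
  simp only [one_mul]
  rfl

theorem superCoeff_superDerivU_of_eq {k : Jet N D} (h : k.2 = 0) (m : PosJet N D →₀ ℕ)
    (I : Finset (Jet N D)) (f : SuperSeries U D) :
    superCoeff m I (superDerivU k f) = partialU k.1 (superCoeff m I f) := by
  change MvPowerSeries.coeff m (derivU k (f I)) = _
  rw [derivU_of_eq h]
  rfl

theorem superCoeff_superDerivU_of_ne {k : Jet N D} (h : k.2 ≠ 0) (m : PosJet N D →₀ ℕ)
    (I : Finset (Jet N D)) (f : SuperSeries U D) :
    superCoeff m I (superDerivU k f) =
      superCoeff (m + Finsupp.single ⟨k, h⟩ 1) I f * ((m ⟨k, h⟩ : Smooth U) + 1) := by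
  change MvPowerSeries.coeff m (derivU k (f I)) = _
  rw [derivU_of_ne h, MvPowerSeries.coeff_pderiv]
  rfl

theorem superCoeff_mulTheta (k : Jet N D) (m : PosJet N D →₀ ℕ) (I : Finset (Jet N D))
    (f : SuperSeries U D) :
    superCoeff m I (mulTheta k f) =
      if k ∈ I then jetSign k I • superCoeff m (I.erase k) f else 0 := by
  change MvPowerSeries.coeff m (mulTheta k f I) = _
  rw [mulTheta_apply]
  split_ifs
  · exact map_zsmul _ _ _
  · exact map_zero _

theorem superCoeff_derivTheta (k : Jet N D) (m : PosJet N D →₀ ℕ) (I : Finset (Jet N D))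
    (f : SuperSeries U D) :
    superCoeff m I (derivTheta k f) =
      if k ∈ I then 0 else jetSign k I • superCoeff m (insert k I) f := by
  change MvPowerSeries.coeff m (derivTheta k f I) = _
  rw [derivTheta_apply]
  split_ifs
  · exact map_zero _
  · exact map_zsmul _ _ _

theorem continuous_mulU (a : PosJet N D) :
    Continuous (mulU a : SuperSeries U D → SuperSeries U D) := by
  refine continuous_superSeries_iff.2 fun m I => ?_
  simp only [superCoeff_mulU]
  split_ifs
  · exact continuous_superCoeff _ _
  · exact continuous_const

theorem continuous_superDerivU (k : Jet N D) :
    Continuous (superDerivU k : SuperSeries U D → SuperSeries U D) := by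
  refine continuous_superSeries_iff.2 fun m I => ?_
  by_cases h : k.2 = 0
  · simp only [superCoeff_superDerivU_of_eq h]
    exact continuous_comp_superCoeff _ _ _
  · simp only [superCoeff_superDerivU_of_ne h]
    exact continuous_comp_superCoeff (· * _) _ _

theorem continuous_mulTheta (k : Jet N D) :
    Continuous (mulTheta k : SuperSeries U D → SuperSeries U D) := by
  refine continuous_superSeries_iff.2 fun m I => ?_
  simp only [superCoeff_mulTheta]
  split_ifs
  · exact continuous_comp_superCoeff (_ • ·) _ _
  · exact continuous_const

theorem continuous_derivTheta (k : Jet N D) :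
    Continuous (derivTheta k : SuperSeries U D → SuperSeries U D) := by
  refine continuous_superSeries_iff.2 fun m I => ?_
  simp only [superCoeff_derivTheta]
  split_ifs
  · exact continuous_const
  · exact continuous_comp_superCoeff (_ • ·) _ _

theorem continuous_gen (a : PosJet N D) (b : Jet N D) :
    Continuous (gen a b : SuperSeries U D → SuperSeries U D) :=
  ((continuous_mulU a).comp (continuous_superDerivU b)).add
    ((continuous_mulTheta a.1).comp (continuous_derivTheta b))

theorem hasSum_totalDeriv (i : Fin D) (f : SuperSeries U D) :
    HasSum (fun k => gen (shiftPos i k) k f) (totalDeriv i f) := by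
  refine hasSum_superSeries_iff.2 fun m I => ?_
  have h := finite_support_gen i m I f
  rw [superCoeff_totalDeriv, ← tsum_eq_finsum (L := .unconditional _) h]
  exact (summable_of_hasFiniteSupport h).hasSum

/-- Each coefficient of `∂_{x^i} f` is computed by one finite partial sum, the same for all `f`. -/
theorem continuous_totalDeriv (i : Fin D) :
    Continuous (totalDeriv i : SuperSeries U D → SuperSeries U D) := by
  refine continuous_superSeries_iff.2 fun m I => ?_
  obtain ⟨W, hW⟩ := superCoeff_totalDeriv_eq (U := U) i m I
  simp only [hW W subset_rfl, partialTotalDeriv_apply]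
  exact (continuous_superCoeff m I).comp (continuous_finsetSum _ fun k _ => continuous_gen _ _)

/-! ### Weights -/

/-- The number of derivatives in the direction `a` in the monomial `u^m θ_I`. -/
def monomialWeight (a : Fin D) (m : PosJet N D →₀ ℕ) (I : Finset (Jet N D)) : ℕ :=
  Finsupp.weight (fun k : PosJet N D => k.1.2 a) m + ∑ k ∈ I, k.2 a

/-- Every summand of `∂_{x^a}` trades a variable with index `S` for one with index `S + ξ_a`,
raising the weight by exactly one. -/
theorem superCoeff_totalDeriv_of_weight_lt {a : Fin D} {t : ℕ} {g : SuperSeries U D}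
    (hg : ∀ m I, monomialWeight a m I < t → superCoeff m I g = 0) (m : PosJet N D →₀ ℕ)
    (I : Finset (Jet N D)) (h : monomialWeight a m I < t + 1) :
    superCoeff m I (totalDeriv a g) = 0 := by
  rw [superCoeff_totalDeriv]
  refine finsum_eq_zero_of_forall_eq_zero fun k => ?_
  have hshift : (shiftPos a k).1.2 a = k.2 a + 1 := by simp [shiftPos, shift]
  rw [gen_apply, map_add, superCoeff_mulU, superCoeff_mulTheta]
  have h1 : Finsupp.single (shiftPos a k) 1 ≤ m →
      superCoeff (m - Finsupp.single (shiftPos a k) 1) I (superDerivU k g) = 0 := by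
    intro hm
    obtain ⟨n, rfl⟩ := exists_add_of_le hm
    rw [add_tsub_cancel_left]
    simp only [monomialWeight, map_add, Finsupp.weight_single, one_smul, hshift] at h
    -- The variable `u^α` lives in the coefficient ring and has weight `0`, so differentiating by it
    -- leaves the monomial alone; for `S ≠ 0` the source monomial is `n` times `u^{α,S}`.
    by_cases hk : k.2 = 0
    · rw [superCoeff_superDerivU_of_eq hk, hg n I (by simp only [monomialWeight]; omega), map_zero]
    · rw [superCoeff_superDerivU_of_ne hk, hg _ I ?_, zero_mul]
      simp only [monomialWeight, map_add, Finsupp.weight_single, one_smul]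
      omega
  have h2 : (shiftPos a k).1 ∈ I →
      superCoeff m (I.erase (shiftPos a k).1) (derivTheta k g) = 0 := by
    intro hI
    rw [superCoeff_derivTheta]
    split_ifs with hk
    · rfl
    · rw [hg, smul_zero]
      have := Finset.add_sum_erase I (fun l => l.2 a) hI
      simp only [monomialWeight, Finset.sum_insert hk] at h ⊢
      omega
  split_ifs with hm hI hI
  · rw [h1 hm, h2 hI, smul_zero, add_zero]
  · rw [h1 hm, add_zero]
  · rw [h2 hI, smul_zero, add_zero]
  · rw [add_zero]

theorem superCoeff_neg_totalDeriv_pow (a : Fin D) (t : ℕ) (g : SuperSeries U D)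
    (m : PosJet N D →₀ ℕ) (I : Finset (Jet N D)) (h : monomialWeight a m I < t) :
    superCoeff m I (((-totalDeriv a) ^ t) g) = 0 := by
  induction t generalizing m I with
  | zero => exact absurd h (Nat.not_lt_zero _)
  | succ t ih =>
    rw [pow_succ', Module.End.mul_apply, LinearMap.neg_apply, map_neg,
      superCoeff_totalDeriv_of_weight_lt ih m I h, neg_zero]

theorem summable_neg_totalDeriv_pow (a : Fin D) (g : ℕ → SuperSeries U D) :
    Summable fun t => ((-totalDeriv a) ^ t) (g t) := by
  refine summable_superSeries fun m I => (Set.finite_Iic (monomialWeight a m I)).subset ?_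
  intro t ht
  by_contra h
  exact ht (superCoeff_neg_totalDeriv_pow a t _ m I (not_le.1 h))

/-! ### Families of series indexed by jet variables (vertical one-forms) -/

/-- The Lie derivative along `∂_{x^i}` of the vertical one-form `∑_k w_k δu^k`. -/
def lieDeriv (i : Fin D) (w : Jet N D → SuperSeries U D) : Jet N D → SuperSeries U D :=
  fun k => totalDeriv i (w k) + Function.extend (shift i) w 0 k

theorem lieDeriv_apply (i : Fin D) (w : Jet N D → SuperSeries U D) (k : Jet N D) :
    lieDeriv i w k = totalDeriv i (w k) + Function.extend (shift i) w 0 k := rfl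

theorem map_extend_shift {T : SuperSeries U D → SuperSeries U D} (hT : T 0 = 0) (i : Fin D)
    (w : Jet N D → SuperSeries U D) (k : Jet N D) :
    T (Function.extend (shift i) w 0 k) = Function.extend (shift i) (fun l => T (w l)) 0 k := by
  rw [Function.apply_extend T]
  congr 1
  exact funext fun _ => hT

/-- The left inverse `w ↦ (∑_t (-∂_{x^a})^t w_{k + (t+1) ξ_a})_k` of `lieDeriv a`. -/
def lieDerivInv (a : Fin D) (w : Jet N D → SuperSeries U D) : Jet N D → SuperSeries U D :=
  fun k => ∑' t : ℕ, ((-totalDeriv a) ^ t) (w ((shift a)^[t + 1] k))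

theorem hasSum_lieDerivInv (a : Fin D) (w : Jet N D → SuperSeries U D) (k : Jet N D) :
    HasSum (fun t : ℕ => ((-totalDeriv a) ^ t) (w ((shift a)^[t + 1] k))) (lieDerivInv a w k) :=
  (summable_neg_totalDeriv_pow a _).hasSum

theorem lieDerivInv_add (a : Fin D) (w v : Jet N D → SuperSeries U D) :
    lieDerivInv a (w + v) = lieDerivInv a w + lieDerivInv a v := by
  ext1 k
  refine (hasSum_lieDerivInv a (w + v) k).unique ?_
  simp only [Pi.add_apply, map_add]
  exact (hasSum_lieDerivInv a w k).add (hasSum_lieDerivInv a v k)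

/-- The series telescopes: its terms are `v_t - v_{t+1}` with `v_t = (-∂_{x^a})^t w_{k+tξ_a}`. The
series of the `v_t` is itself summable, so the difference of the two sums is `v_0 = w_k`. -/
theorem lieDerivInv_lieDeriv (a : Fin D) (w : Jet N D → SuperSeries U D) :
    lieDerivInv a (lieDeriv a w) = w := by
  ext1 k
  refine (hasSum_lieDerivInv a (lieDeriv a w) k).unique ?_
  have hs := (summable_neg_totalDeriv_pow a fun t => w ((shift a)^[t] k)).hasSum
  have hs' := (hasSum_nat_add_iff' 1).2 hs
  have := hs.sub hs'
  rw [sub_sub_cancel, Finset.sum_range_one] at this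
  refine (this.congr_fun fun t => ?_)
  rw [lieDeriv_apply, map_add, Function.iterate_succ_apply' (shift a) t k,
    (shift_injective a).extend_apply, pow_succ, Module.End.mul_apply, LinearMap.neg_apply, map_neg]
  abel

theorem commute_totalDeriv (i j : Fin D) :
    Commute (totalDeriv i : SuperSeries U D →ₗ[ℝ] SuperSeries U D) (totalDeriv j) :=
  LinearMap.ext fun f => totalDeriv_comm i j f

/-- Being in the range of `shift j` means `S_j ≠ 0`, and raising `S_i` with `i ≠ j` does not affect
that. -/
theorem iterate_shift_mem_range {i j : Fin D} (h : i ≠ j) (k : Jet N D) (t : ℕ) :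
    (shift i)^[t] k ∈ Set.range (shift (N := N) j) ↔ k ∈ Set.range (shift (N := N) j) := by
  have key : ∀ l : Jet N D, l ∈ Set.range (shift (N := N) j) ↔ l.2 j ≠ 0 := by
    intro l
    constructor
    · rintro ⟨l, rfl⟩
      simp [shift]
    · intro hl
      refine ⟨(l.1, l.2 - Pi.single j 1), Prod.ext rfl ?_⟩
      refine tsub_add_cancel_of_le fun x => ?_
      by_cases hx : x = j
      · subst hx; simpa using Nat.one_le_iff_ne_zero.2 hl
      · simp [hx]
  induction t with
  | zero => rfl
  | succ t ih =>
    rw [Function.iterate_succ_apply', ← propext ih, key, key]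
    simp [shift, h.symm]

/-- Both ingredients of `lieDeriv j`, namely `∂_{x^j}` and lowering the index by `ξ_j`, commute with
`∂_{x^a}` and with raising the index by `ξ_a`. The second uses `a ≠ j`: for `a = j` lowering can
fail at `k` while being possible at `k + ξ_a`. -/
theorem lieDerivInv_lieDeriv_of_ne {a j : Fin D} (h : a ≠ j) (w : Jet N D → SuperSeries U D) :
    lieDerivInv a (lieDeriv j w) = lieDeriv j (lieDerivInv a w) := by
  ext1 k
  refine (hasSum_lieDerivInv a (lieDeriv j w) k).unique ?_
  simp only [lieDeriv_apply, map_add]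
  refine HasSum.add ?_ ?_
  · refine ((hasSum_lieDerivInv a w k).map (totalDeriv j) (continuous_totalDeriv j)).congr_fun
      fun t => ?_
    exact LinearMap.congr_fun ((commute_totalDeriv (U := U) a j).neg_left.pow_left t) _
  · by_cases hk : k ∈ Set.range (shift (N := N) j)
    · obtain ⟨l, rfl⟩ := hk
      rw [(shift_injective j).extend_apply]
      refine (hasSum_lieDerivInv a w l).congr_fun fun t => ?_
      have : (shift a)^[t + 1] (shift j l) = shift j ((shift a)^[t + 1] l) :=
        (Function.Commute.iterate_left (fun l => shift_comm a j l) (t + 1)) l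
      rw [this, (shift_injective j).extend_apply]
    · rw [Function.extend_apply' _ _ _ hk]
      refine hasSum_zero.congr_fun fun t => ?_
      rw [Function.extend_apply' _ _ _ fun h' => hk ((iterate_shift_mem_range h k (t + 1)).1 h')]
      exact map_zero _

/-! ### The Euler operator -/

variable (c : EuclideanSpace ℝ (Fin N))

/-- The Euler operator `∑ (u^α - c^α) ∂/∂u^α + ∑_{|S| > 0} u^{α,S} ∂/∂u^{α,S} + ∑ θ ∂/∂θ`. -/
def eulerOp : SuperSeries U D →ₗ[ℝ] SuperSeries U D where
  toFun f := fun I m => eulerSmooth c (superCoeff m I f) + (m.degree + I.card) • superCoeff m I f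
  map_add' f g := superSeries_ext fun m I => by
    change eulerSmooth c (superCoeff m I (f + g)) + _ • superCoeff m I (f + g) =
      (eulerSmooth c (superCoeff m I f) + _ • superCoeff m I f) +
        (eulerSmooth c (superCoeff m I g) + _ • superCoeff m I g)
    rw [map_add, map_add, smul_add]
    abel
  map_smul' r f := superSeries_ext fun m I => by
    change eulerSmooth c (superCoeff m I (r • f)) + _ • superCoeff m I (r • f) =
      r • (eulerSmooth c (superCoeff m I f) + _ • superCoeff m I f)
    rw [map_smul, map_smul, smul_add, smul_comm r]

theorem superCoeff_eulerOp (m : PosJet N D →₀ ℕ) (I : Finset (Jet N D)) (f : SuperSeries U D) :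
    superCoeff m I (eulerOp c f) =
      eulerSmooth c (superCoeff m I f) + (m.degree + I.card) • superCoeff m I f := rfl

theorem continuous_eulerOp : Continuous (eulerOp c : SuperSeries U D → SuperSeries U D) :=
  continuous_superSeries_iff.2 fun m I =>
    continuous_comp_superCoeff (fun g => eulerSmooth c g + (m.degree + I.card) • g) m I

/-- Left derivatives `d_k` and multiplications `X_k` by a family of variables, such that
`∑_k X_k d_k` is a part of the Euler operator. -/
structure IsEulerPair (d X : Jet N D → SuperSeries U D →ₗ[ℝ] SuperSeries U D) : Prop where
  deriv_totalDeriv : ∀ i k f,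
    d k (totalDeriv i f) = totalDeriv i (d k f) + Function.extend (shift i) (fun l => d l f) 0 k
  totalDeriv_mul : ∀ i k f, totalDeriv i (X k f) = X k (totalDeriv i f) + X (shift i k) f
  finite_support : ∀ m I (w : Jet N D → SuperSeries U D),
    (Function.support fun k => superCoeff m I (X k (w k))).Finite
  euler_mul : ∀ k f, eulerOp c (X k f) = X k (eulerOp c f + f)

/-- The contraction `∑_k X_k w_k`. -/
def contract (X : Jet N D → SuperSeries U D →ₗ[ℝ] SuperSeries U D)
    (w : Jet N D → SuperSeries U D) : SuperSeries U D :=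
  ∑' k, X k (w k)

namespace IsEulerPair

variable {c} {d X : Jet N D → SuperSeries U D →ₗ[ℝ] SuperSeries U D}

theorem hasSum_contract (h : IsEulerPair c d X) (w : Jet N D → SuperSeries U D) :
    HasSum (fun k => X k (w k)) (contract X w) :=
  (summable_superSeries fun m I => h.finite_support m I w).hasSum

theorem contract_add (h : IsEulerPair c d X) (w v : Jet N D → SuperSeries U D) :
    contract X (w + v) = contract X w + contract X v := by
  refine (h.hasSum_contract (w + v)).unique ?_
  simp only [Pi.add_apply, map_add]
  exact (h.hasSum_contract w).add (h.hasSum_contract v)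

/-- By the rule `totalDeriv_mul`, `∂_{x^i} ∑ X_k w_k = ∑ X_k ∂_{x^i} w_k + ∑ X_{k+ξ_i} w_k`;
reindexing the last sum gives the lowering term of `lieDeriv i`. -/
theorem contract_lieDeriv (h : IsEulerPair c d X) (i : Fin D) (w : Jet N D → SuperSeries U D) :
    contract X (lieDeriv i w) = totalDeriv i (contract X w) := by
  have h1 := (h.hasSum_contract w).map (totalDeriv i) (continuous_totalDeriv i)
  have h2 := h.hasSum_contract fun k => totalDeriv i (w k)
  have h3 : HasSum (fun k => X (shift i k) (w k))
      (totalDeriv i (contract X w) - contract X fun k => totalDeriv i (w k)) := by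
    refine (h1.sub h2).congr_fun fun k => ?_
    simp only [Function.comp_apply, h.totalDeriv_mul]
    abel
  have h4 := (hasSum_extend_zero (shift_injective i)).2 h3
  refine (h.hasSum_contract _).unique ?_
  have h5 := h2.add h4
  rw [add_sub_cancel] at h5
  refine h5.congr_fun fun k => ?_
  rw [lieDeriv_apply, map_add]
  congr 1
  by_cases hk : k ∈ Set.range (shift (N := N) i)
  · obtain ⟨l, rfl⟩ := hk
    rw [(shift_injective i).extend_apply, (shift_injective i).extend_apply]
  · rw [Function.extend_apply' _ _ _ hk, Function.extend_apply' _ _ _ hk]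
    exact map_zero _

theorem lieDeriv_deriv (h : IsEulerPair c d X) (i : Fin D) (f : SuperSeries U D) :
    lieDeriv i (fun k => d k f) = fun k => d k (totalDeriv i f) :=
  funext fun k => (h.deriv_totalDeriv i k f).symm

theorem euler_contract (h : IsEulerPair c d X) (w : Jet N D → SuperSeries U D) :
    eulerOp c (contract X w) = contract X fun k => eulerOp c (w k) + w k := by
  refine HasSum.unique ?_ (h.hasSum_contract fun k => eulerOp c (w k) + w k)
  refine ((h.hasSum_contract w).map (eulerOp c) (continuous_eulerOp c)).congr_fun fun k => ?_
  exact (h.euler_mul k (w k)).symm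

end IsEulerPair

/-- The operator `f ↦ ∑_k X_k R ∑_t (-∂_{x^a})^t d_{k + (t+1) ξ_a} f`, for an operator `R`; it
inverts `∂_{x^a}`, up to constants, when `R = (E + 1)⁻¹` with the Euler operator `E`. -/
def antiTotalDeriv (R : SuperSeries U D →+ SuperSeries U D)
    (d X : Jet N D → SuperSeries U D →ₗ[ℝ] SuperSeries U D) (a : Fin D) (f : SuperSeries U D) :
    SuperSeries U D :=
  contract X fun k => R (lieDerivInv a (fun l => d l f) k)

namespace IsEulerPair

variable {c} {d X : Jet N D → SuperSeries U D →ₗ[ℝ] SuperSeries U D}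
  {R : SuperSeries U D →+ SuperSeries U D}

theorem antiTotalDeriv_add (h : IsEulerPair c d X) (a : Fin D) (f g : SuperSeries U D) :
    antiTotalDeriv R d X a (f + g) = antiTotalDeriv R d X a f + antiTotalDeriv R d X a g := by
  rw [antiTotalDeriv, antiTotalDeriv, antiTotalDeriv, ← h.contract_add]
  have : (fun l => d l (f + g)) = (fun l => d l f) + fun l => d l g :=
    funext fun l => map_add _ _ _
  rw [this, lieDerivInv_add]
  congr 1
  exact funext fun k => map_add R _ _

/-- Differential, series inverse, `R` and contraction each intertwine `∂_{x^j}` with `lieDeriv j` in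
the appropriate way. This is what makes the homotopy descend to the quotient by the earlier
divergences. -/
theorem antiTotalDeriv_totalDeriv_of_ne (h : IsEulerPair c d X)
    (hR : ∀ i f, R (totalDeriv i f) = totalDeriv i (R f)) {a j : Fin D} (haj : a ≠ j)
    (f : SuperSeries U D) :
    antiTotalDeriv R d X a (totalDeriv j f) = totalDeriv j (antiTotalDeriv R d X a f) := by
  rw [antiTotalDeriv, antiTotalDeriv, ← h.contract_lieDeriv, ← h.lieDeriv_deriv,
    lieDerivInv_lieDeriv_of_ne haj]
  congr 1
  ext1 k
  rw [lieDeriv_apply, lieDeriv_apply, map_add, hR, map_extend_shift (map_zero R)]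

/-- Moving `E` through the contraction turns it into `E + 1`, which cancels `R`; the left inverse
then recovers `d_k f` from `d_k ∂_{x^a} f`. -/
theorem euler_antiTotalDeriv (h : IsEulerPair c d X) (hR : ∀ f, eulerOp c (R f) + R f = f)
    (a : Fin D) (f : SuperSeries U D) :
    eulerOp c (antiTotalDeriv R d X a (totalDeriv a f)) = contract X fun k => d k f := by
  rw [antiTotalDeriv, h.euler_contract, ← h.lieDeriv_deriv, lieDerivInv_lieDeriv]
  simp only [hR]

end IsEulerPair

/-! ### The Euler pairs of the variables `u` and `θ` -/

theorem hasSum_ite_shift (i : Fin D) (k : Jet N D) (w : Jet N D → SuperSeries U D) :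
    HasSum (fun l => if k = shift i l then w l else 0) (Function.extend (shift i) w 0 k) := by
  classical
  by_cases hk : k ∈ Set.range (shift (N := N) i)
  · obtain ⟨l, rfl⟩ := hk
    rw [(shift_injective i).extend_apply]
    refine (hasSum_ite_eq l (w l)).congr_fun fun l' => ?_
    by_cases hl : l' = l
    · subst hl; simp
    · rw [if_neg hl, if_neg fun e => hl (shift_injective i e).symm]
  · rw [Function.extend_apply' _ _ _ hk]
    exact hasSum_zero.congr_fun fun l => if_neg fun e => hk ⟨l, e.symm⟩

/-- A continuous operator satisfying the canonical commutation relations of a derivative with the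
operators `gen`. -/
theorem deriv_totalDeriv_of_gen {T : Jet N D → SuperSeries U D →ₗ[ℝ] SuperSeries U D}
    (hT : ∀ k, Continuous (T k)) (h : ∀ k a b f,
      T k (gen a b f) = gen a b (T k f) + if k = a.1 then T b f else 0)
    (i : Fin D) (k : Jet N D) (f : SuperSeries U D) :
    T k (totalDeriv i f) =
      totalDeriv i (T k f) + Function.extend (shift i) (fun l => T l f) 0 k := by
  refine ((hasSum_totalDeriv i f).map (T k) (hT k)).unique ?_
  refine ((hasSum_totalDeriv i (T k f)).add (hasSum_ite_shift i k fun l => T l f)).congr_fun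
    fun l => ?_
  exact h k _ _ f

/-- In the sum over `l` of `gen (shiftPos i l) l`, the commutator with `X k` survives only for `l =
k`. -/
theorem totalDeriv_mul_of_gen {X : Jet N D → SuperSeries U D →ₗ[ℝ] SuperSeries U D}
    (hX : ∀ k, Continuous (X k)) (h : ∀ k (a : PosJet N D) b f,
      gen a b (X k f) = X k (gen a b f) + if b = k then X a.1 f else 0)
    (i : Fin D) (k : Jet N D) (f : SuperSeries U D) :
    totalDeriv i (X k f) = X k (totalDeriv i f) + X (shift i k) f := by
  classical
  refine (hasSum_totalDeriv i (X k f)).unique ?_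
  refine (((hasSum_totalDeriv i f).map (X k) (hX k)).add
    (hasSum_ite_eq k (X (shift i k) f))).congr_fun fun l => ?_
  rw [h]
  by_cases hl : l = k
  · subst hl; rw [if_pos rfl, if_pos rfl]; rfl
  · rw [if_neg hl, if_neg hl]; rfl

/-- Multiplication by a smooth function. -/
def mulSmooth (g : Smooth U) : SuperSeries U D →ₗ[ℝ] SuperSeries U D where
  toFun f := fun I m => g * superCoeff m I f
  map_add' f f' := superSeries_ext fun m I => mul_add g (superCoeff m I f) (superCoeff m I f')
  map_smul' r f := superSeries_ext fun m I => mul_smul_comm r g (superCoeff m I f)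

theorem superCoeff_mulSmooth (g : Smooth U) (m : PosJet N D →₀ ℕ) (I : Finset (Jet N D))
    (f : SuperSeries U D) : superCoeff m I (mulSmooth g f) = g * superCoeff m I f := rfl

/-- Multiplication by `u^{α,S}`, if `|S| > 0`, and by `u^α - c^α`, if `S = 0`. -/
def mulCenteredU (k : Jet N D) : SuperSeries U D →ₗ[ℝ] SuperSeries U D :=
  if h : k.2 = 0 then mulSmooth (centeredCoord U c k.1) else mulU ⟨k, h⟩

theorem mulCenteredU_of_eq {k : Jet N D} (h : k.2 = 0) :
    mulCenteredU (U := U) c k = mulSmooth (centeredCoord U c k.1) := dif_pos h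

theorem mulCenteredU_of_ne {k : Jet N D} (h : k.2 ≠ 0) :
    mulCenteredU (U := U) c k = mulU ⟨k, h⟩ := dif_neg h

theorem continuous_mulSmooth (g : Smooth U) :
    Continuous (mulSmooth g : SuperSeries U D → SuperSeries U D) :=
  continuous_superSeries_iff.2 fun m I => continuous_comp_superCoeff (g * ·) m I

theorem continuous_mulCenteredU (k : Jet N D) :
    Continuous (mulCenteredU c k : SuperSeries U D → SuperSeries U D) := by
  by_cases h : k.2 = 0
  · rw [mulCenteredU_of_eq c h]; exact continuous_mulSmooth _
  · rw [mulCenteredU_of_ne c h]; exact continuous_mulU _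

/-! ### Commutation relations with the multiplication operators -/

theorem mulU_mulSmooth (a : PosJet N D) (g : Smooth U) (f : SuperSeries U D) :
    mulU a (mulSmooth g f) = mulSmooth g (mulU a f) := by
  refine superSeries_ext fun m I => ?_
  simp only [superCoeff_mulU, superCoeff_mulSmooth, mul_ite, mul_zero]

theorem mulTheta_mulSmooth (k : Jet N D) (g : Smooth U) (f : SuperSeries U D) :
    mulTheta k (mulSmooth g f) = mulSmooth g (mulTheta k f) := by
  refine superSeries_ext fun m I => ?_
  simp only [superCoeff_mulTheta, superCoeff_mulSmooth, mul_ite, mul_zero, mul_smul_comm]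

theorem derivTheta_mulSmooth (k : Jet N D) (g : Smooth U) (f : SuperSeries U D) :
    derivTheta k (mulSmooth g f) = mulSmooth g (derivTheta k f) := by
  refine superSeries_ext fun m I => ?_
  simp only [superCoeff_derivTheta, superCoeff_mulSmooth, mul_ite, mul_zero, mul_smul_comm]

theorem superDerivU_mulSmooth_centeredCoord {k : Jet N D} (hk : k.2 = 0) (b : Jet N D)
    (f : SuperSeries U D) :
    superDerivU b (mulSmooth (centeredCoord U c k.1) f) =
      (if b = k then f else 0) + mulSmooth (centeredCoord U c k.1) (superDerivU b f) := by
  refine superSeries_ext fun m I => ?_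
  rw [map_add, superCoeff_mulSmooth]
  by_cases hb : b.2 = 0
  · rw [superCoeff_superDerivU_of_eq hb, superCoeff_superDerivU_of_eq hb, superCoeff_mulSmooth,
      partialU_mul, partialU_centeredCoord, add_comm]
    by_cases hbk : b = k
    · subst hbk; simp
    · rw [if_neg fun e => hbk (Prod.ext e (hb.trans hk.symm)), if_neg hbk, zero_mul, map_zero]
  · rw [superCoeff_superDerivU_of_ne hb, superCoeff_superDerivU_of_ne hb, superCoeff_mulSmooth,
      if_neg fun e => hb (by rw [e, hk]), map_zero, zero_add, mul_assoc]

theorem superDerivU_mulCenteredU (b k : Jet N D) (f : SuperSeries U D) :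
    superDerivU b (mulCenteredU c k f) =
      (if b = k then f else 0) + mulCenteredU c k (superDerivU b f) := by
  by_cases h : k.2 = 0
  · rw [mulCenteredU_of_eq c h, superDerivU_mulSmooth_centeredCoord c h]
  · rw [mulCenteredU_of_ne c h, superDerivU_mulU]

theorem mulU_mulCenteredU (a : PosJet N D) (k : Jet N D) (f : SuperSeries U D) :
    mulU a (mulCenteredU c k f) = mulCenteredU c k (mulU a f) := by
  by_cases h : k.2 = 0
  · rw [mulCenteredU_of_eq c h, mulU_mulSmooth]
  · rw [mulCenteredU_of_ne c h, mulU_comm]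

theorem mulTheta_mulCenteredU (l k : Jet N D) (f : SuperSeries U D) :
    mulTheta l (mulCenteredU c k f) = mulCenteredU c k (mulTheta l f) := by
  by_cases h : k.2 = 0
  · rw [mulCenteredU_of_eq c h, mulTheta_mulSmooth]
  · rw [mulCenteredU_of_ne c h, mulU_mulTheta]

theorem derivTheta_mulCenteredU (l k : Jet N D) (f : SuperSeries U D) :
    derivTheta l (mulCenteredU c k f) = mulCenteredU c k (derivTheta l f) := by
  by_cases h : k.2 = 0
  · rw [mulCenteredU_of_eq c h, derivTheta_mulSmooth]
  · rw [mulCenteredU_of_ne c h, mulU_derivTheta]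

theorem superDerivU_gen (k : Jet N D) (a : PosJet N D) (b : Jet N D) (f : SuperSeries U D) :
    superDerivU k (gen a b f) =
      gen a b (superDerivU k f) + if k = a.1 then superDerivU b f else 0 := by
  rw [gen_apply, gen_apply, map_add, superDerivU_mulU, superDerivU_mulTheta,
    superDerivU_derivTheta, superDerivU_comm k b]
  abel

theorem derivTheta_gen (k : Jet N D) (a : PosJet N D) (b : Jet N D) (f : SuperSeries U D) :
    derivTheta k (gen a b f) =
      gen a b (derivTheta k f) + if k = a.1 then derivTheta b f else 0 := by
  rw [gen_apply, gen_apply, map_add, derivTheta_mulTheta, ← mulU_derivTheta,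
    superDerivU_derivTheta, derivTheta_anticomm k b, map_neg]
  abel

theorem gen_mulCenteredU (k : Jet N D) (a : PosJet N D) (b : Jet N D) (f : SuperSeries U D) :
    gen a b (mulCenteredU c k f) =
      mulCenteredU c k (gen a b f) + if b = k then mulCenteredU c a.1 f else 0 := by
  rw [gen_apply, gen_apply, superDerivU_mulCenteredU, derivTheta_mulCenteredU,
    mulTheta_mulCenteredU, map_add, map_add, mulU_mulCenteredU, mulCenteredU_of_ne c a.2]
  split_ifs
  · abel
  · rw [map_zero]; abel

theorem gen_mulTheta (k : Jet N D) (a : PosJet N D) (b : Jet N D) (f : SuperSeries U D) :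
    gen a b (mulTheta k f) =
      mulTheta k (gen a b f) + if b = k then mulTheta a.1 f else 0 := by
  rw [gen_apply, gen_apply, superDerivU_mulTheta, derivTheta_mulTheta, mulU_mulTheta, map_sub,
    mulTheta_anticomm a.1 k, map_add]
  split_ifs
  · abel
  · rw [map_zero]; abel

theorem eulerOp_mulU (a : PosJet N D) (f : SuperSeries U D) :
    eulerOp c (mulU a f) = mulU a (eulerOp c f + f) := by
  refine superSeries_ext fun m I => ?_
  rw [superCoeff_eulerOp, superCoeff_mulU, superCoeff_mulU]
  split_ifs with h
  · obtain ⟨n, rfl⟩ := exists_add_of_le h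
    rw [add_tsub_cancel_left, map_add Finsupp.degree, Finsupp.degree_single,
      map_add (superCoeff n I), superCoeff_eulerOp, add_assoc (eulerSmooth c _), ← succ_nsmul,
      add_assoc, add_comm 1]
  · rw [map_zero, smul_zero, add_zero]

theorem eulerOp_mulTheta (k : Jet N D) (f : SuperSeries U D) :
    eulerOp c (mulTheta k f) = mulTheta k (eulerOp c f + f) := by
  refine superSeries_ext fun m I => ?_
  rw [superCoeff_eulerOp, superCoeff_mulTheta, superCoeff_mulTheta]
  split_ifs with h
  · rw [map_zsmul, smul_comm, ← smul_add, map_add (superCoeff m _), superCoeff_eulerOp, add_assoc,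
      ← succ_nsmul, add_assoc, Finset.card_erase_add_one h]
  · rw [map_zero, smul_zero, add_zero]

theorem eulerOp_mulCenteredU (k : Jet N D) (f : SuperSeries U D) :
    eulerOp c (mulCenteredU c k f) = mulCenteredU c k (eulerOp c f + f) := by
  by_cases h : k.2 = 0
  · rw [mulCenteredU_of_eq c h]
    refine superSeries_ext fun m I => ?_
    rw [superCoeff_eulerOp, superCoeff_mulSmooth, superCoeff_mulSmooth,
      eulerSmooth_centeredCoord_mul, map_add, superCoeff_eulerOp, ← mul_smul_comm, ← mul_add]
    congr 1
    abel
  · rw [mulCenteredU_of_ne c h, eulerOp_mulU]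

theorem isEulerPair_u :
    IsEulerPair c (superDerivU : Jet N D → SuperSeries U D →ₗ[ℝ] SuperSeries U D)
      (mulCenteredU c) where
  deriv_totalDeriv := deriv_totalDeriv_of_gen continuous_superDerivU superDerivU_gen
  totalDeriv_mul := totalDeriv_mul_of_gen (continuous_mulCenteredU c) (gen_mulCenteredU c)
  finite_support m I w := by
    -- Besides the variables occurring in `u^m`, the `N` coordinates of order zero may contribute to
    -- any coefficient.
    refine ((m.support.finite_toSet.image Subtype.val).union
      (Set.finite_range fun α : Fin N => ((α, 0) : Jet N D))).subset fun k hk => ?_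
    by_cases h : k.2 = 0
    · exact Or.inr ⟨k.1, Prod.ext rfl h.symm⟩
    · refine Or.inl ⟨⟨k, h⟩, ?_, rfl⟩
      by_contra hm
      refine hk ?_
      simp only [mulCenteredU_of_ne c h]
      rw [superCoeff_mulU, if_neg]
      rw [Finsupp.single_le_iff]
      simpa using hm
  euler_mul := eulerOp_mulCenteredU c

theorem isEulerPair_theta :
    IsEulerPair c (derivTheta : Jet N D → SuperSeries U D →ₗ[ℝ] SuperSeries U D) mulTheta where
  deriv_totalDeriv := deriv_totalDeriv_of_gen continuous_derivTheta derivTheta_gen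
  totalDeriv_mul := totalDeriv_mul_of_gen continuous_mulTheta gen_mulTheta
  finite_support m I w := by
    refine I.finite_toSet.subset fun k hk => ?_
    by_contra hm
    refine hk ?_
    simp only [superCoeff_mulTheta]
    exact if_neg hm
  euler_mul := eulerOp_mulTheta c

/-- Removing and restoring `θ_k` produces the same sign twice, so `θ_k ∂/∂θ_k` is the number
operator of `θ_k`. -/
theorem superCoeff_mulTheta_derivTheta (k : Jet N D) (m : PosJet N D →₀ ℕ)
    (I : Finset (Jet N D)) (f : SuperSeries U D) :
    superCoeff m I (mulTheta k (derivTheta k f)) = if k ∈ I then superCoeff m I f else 0 := by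
  rw [superCoeff_mulTheta, superCoeff_derivTheta]
  split_ifs with h h'
  · exact absurd h' (Finset.notMem_erase k I)
  · rw [Finset.insert_erase h, smul_smul, jetSign_erase_self, jetSign_mul_self, one_smul]
  · rfl

theorem superCoeff_mulU_superDerivU (k : PosJet N D) (m : PosJet N D →₀ ℕ)
    (I : Finset (Jet N D)) (f : SuperSeries U D) :
    superCoeff m I (mulU k (superDerivU k.1 f)) = m k • superCoeff m I f := by
  rw [superCoeff_mulU, superCoeff_superDerivU_of_ne k.2]
  split_ifs with h
  · rw [tsub_add_cancel_of_le h, nsmul_eq_mul, mul_comm]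
    congr 1
    rw [Finsupp.tsub_apply, Finsupp.single_eq_same, ← Nat.cast_add_one,
      tsub_add_cancel_of_le (Finsupp.single_le_iff.1 h)]
  · rw [Finsupp.single_le_iff, not_le, Nat.lt_one_iff] at h
    rw [h, zero_smul]

/-- `E = ∑_k (u^k ∂/∂u^k + θ_k ∂/∂θ_k)`. -/
theorem eulerOp_eq_contract (f : SuperSeries U D) :
    eulerOp c f = contract (mulCenteredU c) (fun k => superDerivU k f) +
      contract mulTheta fun k => derivTheta k f := by
  classical
  have hu := (isEulerPair_u (U := U) (D := D) c).hasSum_contract fun k => superDerivU k f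
  have ht := (isEulerPair_theta (U := U) (D := D) c).hasSum_contract fun k => derivTheta k f
  refine superSeries_ext fun m I => ?_
  rw [map_add, superCoeff_eulerOp, add_smul, ← add_assoc]
  have ht' := hasSum_superSeries_iff.1 ht m I
  have hu' := hasSum_superSeries_iff.1 hu m I
  have e2 : superCoeff m I (contract mulTheta fun k => derivTheta k f) =
      I.card • superCoeff m I f := by
    refine ht'.unique ?_
    rw [← Finset.sum_const, ← Finset.sum_congr rfl fun k hk =>
      (superCoeff_mulTheta_derivTheta k m I f).trans (if_pos hk)]
    exact hasSum_sum_of_ne_finset_zero fun k hk =>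
      (superCoeff_mulTheta_derivTheta k m I f).trans (if_neg hk)
  -- The contraction splits by order: the coordinates `u^α` give `eulerSmooth` on the coefficient,
  -- and the variables with `|S| > 0` count the degree of `u^m`.
  have e1 : superCoeff m I (contract (mulCenteredU c) fun k => superDerivU k f) =
      eulerSmooth c (superCoeff m I f) + m.degree • superCoeff m I f := by
    have hinj : Function.Injective fun α : Fin N => ((α, 0) : Jet N D) :=
      fun α β h => congrArg Prod.fst h
    have h0 : HasSum (Function.extend (fun α : Fin N => ((α, 0) : Jet N D))
        (fun α => centeredCoord U c α * partialU α (superCoeff m I f)) 0)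
        (eulerSmooth c (superCoeff m I f)) := by
      rw [hasSum_extend_zero hinj, eulerSmooth_eq_sum]
      exact hasSum_fintype _
    have h1 : HasSum (Function.extend (Subtype.val : PosJet N D → Jet N D)
        (fun k => m k • superCoeff m I f) 0) (m.degree • superCoeff m I f) := by
      rw [hasSum_extend_zero Subtype.val_injective, Finsupp.degree_apply, Finset.sum_smul]
      exact hasSum_sum_of_ne_finset_zero fun k hk => by
        rw [Finsupp.notMem_support_iff.1 hk, zero_smul]
    refine hu'.unique ((h0.add h1).congr_fun fun k => ?_)
    by_cases h : k.2 = 0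
    · obtain ⟨α, S⟩ := k
      obtain rfl : S = 0 := h
      have hk : ((α, 0) : Jet N D) ∉ Set.range (Subtype.val : PosJet N D → Jet N D) := by
        rintro ⟨l, hl⟩
        exact l.2 (by rw [hl])
      rw [Function.extend_apply' _ _ _ hk, mulCenteredU_of_eq c rfl, superCoeff_mulSmooth,
        superCoeff_superDerivU_of_eq rfl]
      exact (congrArg (· + (0 : Smooth U)) (hinj.extend_apply _ _ α)).symm ▸ (add_zero _).symm
    · have hk : k ∉ Set.range fun α : Fin N => ((α, 0) : Jet N D) := by
        rintro ⟨l, rfl⟩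
        exact h rfl
      rw [Function.extend_apply' _ _ _ hk, mulCenteredU_of_ne c h]
      have := (Subtype.val_injective (p := fun k : Jet N D => k.2 ≠ 0)).extend_apply
        (fun k => m k • superCoeff m I f) 0 ⟨k, h⟩
      rw [this, superCoeff_mulU_superDerivU ⟨k, h⟩]
      exact (zero_add _).symm
  rw [e1, e2]

/-- `E` is the differential followed by contraction, and these intertwine `∂_{x^i}` with `lieDeriv
i` and back. -/
theorem eulerOp_totalDeriv (i : Fin D) (f : SuperSeries U D) :
    eulerOp c (totalDeriv i f) = totalDeriv i (eulerOp c f) := by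
  have hu := isEulerPair_u (U := U) (D := D) c
  have ht := isEulerPair_theta (U := U) (D := D) c
  rw [eulerOp_eq_contract, eulerOp_eq_contract, map_add, ← hu.contract_lieDeriv,
    ← ht.contract_lieDeriv, hu.lieDeriv_deriv, ht.lieDeriv_deriv]

/-! ### Exactness -/

section Ball

variable {c} {r : ℝ}

/-- The operator does not mix monomials: on the coefficient of `u^m θ_I` it is `eulerSmooth` plus
the positive integer `|m| + |I| + 1`. -/
theorem bijective_eulerOp_add_id (hU : (U : Set (EuclideanSpace ℝ (Fin N))) = Metric.ball c r) :
    Function.Bijective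
      (eulerOp c + LinearMap.id : SuperSeries U D →ₗ[ℝ] SuperSeries U D).toAddMonoidHom := by
  have hco : ∀ (m : PosJet N D →₀ ℕ) (I : Finset (Jet N D)) (f : SuperSeries U D),
      superCoeff m I ((eulerOp c + LinearMap.id : SuperSeries U D →ₗ[ℝ] SuperSeries U D) f) =
        eulerSmooth c (superCoeff m I f) + (m.degree + I.card + 1) • superCoeff m I f := by
    intro m I f
    rw [LinearMap.add_apply, map_add, superCoeff_eulerOp, add_assoc, succ_nsmul]
    rfl
  have hb := fun n => bijective_eulerSmooth_add_nsmul hU n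
  refine ⟨fun f g hfg => superSeries_ext fun m I => (hb (m.degree + I.card)).1 ?_, fun g => ?_⟩
  · exact (hco m I f).symm.trans ((congrArg (superCoeff m I) hfg).trans (hco m I g))
  · choose F hF using fun (m : PosJet N D →₀ ℕ) (I : Finset (Jet N D)) =>
      (hb (m.degree + I.card)).2 (superCoeff m I g)
    exact ⟨fun I m => F m I, superSeries_ext fun m I => (hco m I _).trans (hF m I)⟩

/-- The factor `0 ^ (|m| + |I|)` kills every coefficient except that of the trivial monomial, which
must be the constant function with its value at the centre. -/
theorem mem_range_constSeries_of_eulerOp_eq_zero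
    (hU : (U : Set (EuclideanSpace ℝ (Fin N))) = Metric.ball c r) {f : SuperSeries U D}
    (hf : eulerOp c f = 0) : f ∈ LinearMap.range (constSeries U D) := by
  refine ⟨extendZero (superCoeff 0 ∅ f) c, superSeries_ext fun m I => ?_⟩
  have h := eq_of_eulerSmooth_add_nsmul_eq_zero hU (m.degree + I.card)
    (f := superCoeff m I f) (by rw [← superCoeff_eulerOp, hf, map_zero])
  ext x
  rw [h x]
  change MvPowerSeries.coeff m (constSeries U D _ I) x = _
  rw [constSeries_apply]
  by_cases hI : I = ∅
  · subst hI
    by_cases hm : m = 0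
    · subst hm
      rw [if_pos rfl, MvPowerSeries.algebraMap_apply, MvPowerSeries.coeff_zero_C, map_zero,
        Finset.card_empty, add_zero, pow_zero, one_mul]
      rfl
    · rw [if_pos rfl, MvPowerSeries.algebraMap_apply, MvPowerSeries.coeff_C, if_neg hm,
        zero_pow (by simpa [Finsupp.degree_eq_zero_iff] using hm), zero_mul]
      rfl
  · rw [if_neg hI, zero_pow (by simp [hI]), zero_mul, map_zero]
    rfl

/-- If `∂_{x^a} f` is a divergence in the directions before `a`, then so is `f`, up to a
constant. -/
theorem exists_sub_constSeries_mem_divergences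
    (hU : (U : Set (EuclideanSpace ℝ (Fin N))) = Metric.ball c r) (a : Fin D)
    {f : SuperSeries U D} (hf : totalDeriv a f ∈ divergences U D a) :
    ∃ t : ℝ, f - constSeries U D t ∈ divergences U D a := by
  have hu := isEulerPair_u (U := U) (D := D) c
  have ht := isEulerPair_theta (U := U) (D := D) c
  let e := AddEquiv.ofBijective _ (bijective_eulerOp_add_id (D := D) hU)
  let R : SuperSeries U D →+ SuperSeries U D := e.symm.toAddMonoidHom
  have hR : ∀ f, eulerOp c (R f) + R f = f := e.apply_symm_apply
  -- The inverse of `E + 1` commutes with `∂_{x^i}` because `E` does.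
  have hRc : ∀ i f, R (totalDeriv i f) = totalDeriv i (R f) := by
    intro i f
    refine e.injective ((e.apply_symm_apply _).trans ?_)
    change _ = eulerOp c (totalDeriv i (R f)) + totalDeriv i (R f)
    rw [eulerOp_totalDeriv, ← map_add, hR]
  let H : SuperSeries U D → SuperSeries U D := fun f =>
    antiTotalDeriv R superDerivU (mulCenteredU c) a f + antiTotalDeriv R derivTheta mulTheta a f
  have hadd : ∀ f g, H (f + g) = H f + H g := by
    intro f g
    simp only [H, hu.antiTotalDeriv_add, ht.antiTotalDeriv_add]
    abel
  have hH : ∀ g ∈ divergences U D a, H g ∈ divergences U D a := by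
    intro g hg
    induction hg using Submodule.iSup_induction' with
    | mem j g hg =>
      obtain ⟨g, rfl⟩ := hg
      -- Only directions strictly before `a` occur here, so the commutation for distinct directions
      -- applies.
      have hj : a ≠ j.1 := fun e => j.2.ne (congrArg Fin.val e).symm
      simp only [H, hu.antiTotalDeriv_totalDeriv_of_ne hRc hj,
        ht.antiTotalDeriv_totalDeriv_of_ne hRc hj, ← map_add]
      exact Submodule.mem_iSup_of_mem j ⟨_, rfl⟩
    | zero =>
      have : H 0 = 0 := by simpa using hadd 0 0
      rw [this]
      exact zero_mem _
    | add f g _ _ hf hg =>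
      rw [hadd]
      exact add_mem hf hg
  -- Together the `u` and `θ` parts of `E H ∂_{x^a} f` are the two contractions that add up to `E
  -- f`.
  have hE : eulerOp c (f - H (totalDeriv a f)) = 0 := by
    simp only [H, map_sub, map_add, hu.euler_antiTotalDeriv hR, ht.euler_antiTotalDeriv hR]
    rw [← eulerOp_eq_contract, sub_self]
  obtain ⟨t, ht⟩ := mem_range_constSeries_of_eulerOp_eq_zero hU hE
  refine ⟨t, ?_⟩
  rw [ht, sub_sub_cancel]
  exact hH _ hf

theorem ker_totalDerivF (hU : (U : Set (EuclideanSpace ℝ (Fin N))) = Metric.ball c r)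
    (a : Fin D) : LinearMap.ker (totalDerivF U a (a : ℕ)) = constants U D (a : ℕ) := by
  refine le_antisymm (fun x hx => ?_) (constants_le_ker U a a)
  obtain ⟨f, rfl⟩ := Submodule.mkQ_surjective _ x
  have hf : totalDeriv a f ∈ divergences U D a := by
    rw [LinearMap.mem_ker] at hx
    exact (Submodule.Quotient.mk_eq_zero _).1 hx
  obtain ⟨t, ht⟩ := exists_sub_constSeries_mem_divergences hU a hf
  exact ⟨t, ((Submodule.Quotient.eq _).2 ht).symm⟩

theorem divergences_succ (U : TopologicalSpace.Opens (EuclideanSpace ℝ (Fin N))) (a : Fin D) :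
    divergences U D (a + 1) = divergences U D a ⊔ LinearMap.range (totalDeriv a) := by
  refine le_antisymm (iSup_le fun j => ?_) (sup_le (divergences_mono U (Nat.le_succ _)) ?_)
  · rcases (Nat.lt_succ_iff.1 j.2).lt_or_eq with h | h
    · exact (le_iSup (fun l : {l : Fin D // (l : ℕ) < a} =>
        LinearMap.range (totalDeriv (U := U) l.1)) ⟨j.1, h⟩).trans le_sup_left
    · rw [Fin.ext h]
      exact le_sup_right
  · exact le_iSup (fun l : {l : Fin D // (l : ℕ) < a + 1} =>
      LinearMap.range (totalDeriv (U := U) l.1)) ⟨a, Nat.lt_succ_self _⟩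

/-- Pure linear algebra: a class dies in the next quotient exactly when a representative is an
earlier divergence plus some `∂_{x^a} h`. -/
theorem exact_totalDerivModConst (U : TopologicalSpace.Opens (EuclideanSpace ℝ (Fin N)))
    (a : Fin D) :
    Function.Exact (totalDerivModConst U a (a : ℕ)) (partialIntegral U D (a : ℕ)) := by
  intro x
  obtain ⟨f, rfl⟩ := Submodule.mkQ_surjective _ x
  have h1 : partialIntegral U D a ((divergences U D a).mkQ f) = 0 ↔
      f ∈ divergences U D (a + 1) := Submodule.Quotient.mk_eq_zero _
  rw [h1, divergences_succ, Submodule.mem_sup]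
  constructor
  · rintro ⟨g, hg, _, ⟨h, rfl⟩, rfl⟩
    refine ⟨(constants U D a).mkQ ((divergences U D a).mkQ h), ?_⟩
    refine (Submodule.Quotient.eq _).2 ?_
    rw [sub_add_cancel_right]
    exact neg_mem hg
  · rintro ⟨y, hy⟩
    obtain ⟨y, rfl⟩ := Submodule.mkQ_surjective _ y
    obtain ⟨h, rfl⟩ := Submodule.mkQ_surjective _ y
    exact ⟨f - totalDeriv a h, (Submodule.Quotient.eq _).1 hy.symm, _, ⟨h, rfl⟩,
      sub_add_cancel _ _⟩

end Ball

end Topology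

end JetCalculus

end

-- Directions are counted from `0`, so for `a : Fin D` the index `(a : ℕ)` is the number of
-- directions before `a`: the quotient at this index is the `F̂_{a-1}` of the one-based statement.
-- Injectivity of the first map is the kernel computation, read modulo the constants.
open JetCalculus in
theorem mainTheorem3 {N D : ℕ} (U : TopologicalSpace.Opens (EuclideanSpace ℝ (Fin N)))
    (c : EuclideanSpace ℝ (Fin N)) (r : ℝ) (hr : 0 < r)
    (hU : (U : Set (EuclideanSpace ℝ (Fin N))) = Metric.ball c r) (a : Fin D) :
    (Function.Injective (totalDerivModConst U a (a : ℕ)) ∧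
      Function.Exact (totalDerivModConst U a (a : ℕ)) (partialIntegral U D (a : ℕ)) ∧
      Function.Surjective (partialIntegral U D (a : ℕ))) ∧
    LinearMap.ker (totalDerivF U a (a : ℕ)) = constants U D (a : ℕ) := by
  refine ⟨⟨?_, exact_totalDerivModConst U a,
    Submodule.factor_surjective (divergences_mono U (Nat.le_succ _))⟩, ker_totalDerivF hU a⟩
  rw [← LinearMap.ker_eq_bot]
  exact Submodule.ker_liftQ_eq_bot _ _ _ (ker_totalDerivF hU a).le
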